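/- Let $X$ be a compact geodesic metric space (any two points $x,y$ are joined by an isometric embedding of $[0,d(x,y)]$) with basepoint $\bullet\in X$. For $r>0$ let $\mathrm{Rips}(X,r)$ be the open Rips complex, whose simplices are the nonempty finite subsets of $X$ of diameter less than $r$. A number $p>0$ is a critical value (of the open-Rips $\pi_1$-persistence of $X$) if either for all sufficiently small $\varepsilon>0$ the inclusion-induced map $\pi_1(\mathrm{Rips}(X,p-\varepsilon),\bullet)\to\pi_1(\mathrm{Rips}(X,p),\bullet)$ is not an isomorphism, or for all $\varepsilon>0$ the inclusion-induced map $\pi_1(\mathrm{Rips}(X,p),\bullet)\to\pi_1(\mathrm{Rips}(X,p+\varepsilon),\bullet)$ is not an isomorphism. A lasso is a loop $\alpha*\beta*\alpha^-$, where $\alpha$ is a path in $X$ starting at $\bullet$ and $\beta$ is a loop based at the endpoint of $\alpha$. Let $\mathcal L(X,r,\pi_1)\le\pi_1(X,\bullet)$ be the subgroup generated by the lassos for which $\beta$ has length less than $r$, and let $\mathcal S(X,r,\pi_1)\le\pi_1(X,\bullet)$ be the subgroup generated by the lassos for which $\beta$ lies in a closed ball $\overline B(x,d)$ for some $x\in X$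 and some $d<r$. A geodesic circle of length $l>0$ is an isometric embedding into $X$ of the circle of circumference $l$ with its arc-length metric. A geodesic $l$-lasso is a lasso $\alpha*\beta*\alpha^-$ such that $\beta$ traverses a geodesic circle of length $l$ once; here $\alpha$ is an arbitrary path from $\bullet$ to a point of the circle. Then the following hold. (a) For each $r>0$ there are only finitely many critical values greater than $r$. (b) If $q<p$ are consecutive critical values, then $\mathcal L(X,3p,\pi_1)$ is generated by $\mathcal L(X,3q,\pi_1)$ together with (the homotopy classes of) a collection of geodesic $3q$-lassos. (c) For every critical value $q$ there is a geodesic circle of length $3q$ in $X$. (d) If $q<p$ are consecutive critical values and $A$ is any collection of geodesic $3q$-lassos as in (b), that is, one which together with $\mathcal L(X,3q,\pi_1)$ generates $\mathcal L(X,3p,\pi_1)$, then $\mathcal S(X,3p/2,\pi_1)$ is generated by $\mathcal S(X,3q/2,\pi_1)$ together with $A$. -/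

import Mathlib

noncomputable section

namespace RipsPersistence

/-! ### Geometric realization of an abstract simplicial complex -/

section Realization

variable {ι : Type*}

/-- A point of the geometric realization of `K`, given by its barycentric coordinates: a finitely
supported nonnegative weight on the vertices of total mass one whose support is a simplex. -/
@[ext]
structure Realization (K : AbstractSimplicialComplex ι) where
  weight : ι →₀ ℝ
  nonneg : ∀ v, 0 ≤ weight v
  sum_eq_one : (weight.sum fun _ a => a) = 1
  support_mem : weight.support ∈ K.faces

/-- The closed simplex of the realization spanned by the vertices in `σ`. -/
structure ClosedSimplex (K : AbstractSimplicialComplex ι) (σ : Finset ι) where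
  point : Realization K
  support_subset : point.weight.support ⊆ σ

/-- A closed simplex carries the Euclidean topology of barycentric coordinates. -/
instance (K : AbstractSimplicialComplex ι) (σ : Finset ι) :
    TopologicalSpace (ClosedSimplex K σ) :=
  TopologicalSpace.induced (fun w => (w.point.weight : ι → ℝ)) inferInstance

/-- The weak (coherent) topology: a set is open iff its trace on each closed simplex is open. -/
instance (K : AbstractSimplicialComplex ι) : TopologicalSpace (Realization K) :=
  ⨆ σ : K.faces, TopologicalSpace.coinduced
    (fun w : ClosedSimplex K σ.1 => w.point) inferInstance

theorem isOpen_realization_iff {K : AbstractSimplicialComplex ι} {U : Set (Realization K)} :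
    IsOpen U ↔ ∀ σ ∈ K.faces, IsOpen {w : ClosedSimplex K σ | w.point ∈ U} := by
  rw [isOpen_iSup_iff, Subtype.forall]
  rfl

/-- The point of the realization given by a vertex. -/
def Realization.vertex (K : AbstractSimplicialComplex ι) (v : ι) : Realization K where
  weight := Finsupp.single v 1
  nonneg w := by
    classical
    rw [Finsupp.single_apply]
    split_ifs <;> norm_num
  sum_eq_one := by simp
  support_mem := by
    rw [Finsupp.support_single v one_ne_zero]
    exact K.singleton_mem v

/-- The inclusion of the realization of a subcomplex. -/
def Realization.inclusion {K L : AbstractSimplicialComplex ι} (h : K ≤ L) :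
    C(Realization K, Realization L) where
  toFun w := ⟨w.weight, w.nonneg, w.sum_eq_one, h w.support_mem⟩
  continuous_toFun := by
    refine continuous_def.2 fun U hU => isOpen_realization_iff.2 fun σ hσ => ?_
    have hc : Continuous (fun w : ClosedSimplex K σ =>
        (⟨⟨w.point.weight, w.point.nonneg, w.point.sum_eq_one, h w.point.support_mem⟩,
          w.support_subset⟩ : ClosedSimplex L σ)) :=
      continuous_induced_rng.2 continuous_induced_dom
    exact (isOpen_realization_iff.1 hU σ (h hσ)).preimage hc

end Realization

/-! ### The open Rips filtration and its `π₁`-persistence -/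

variable {X : Type*} [MetricSpace X]

/-- The open Rips complex `Rips(X, r)`, `r > 0`: the nonempty finite subsets of `X` of diameter
less than `r`. -/
def rips (X : Type*) [MetricSpace X] (r : ℝ) (hr : 0 < r) : AbstractSimplicialComplex X where
  faces := {σ | σ.Nonempty ∧ Metric.diam (σ : Set X) < r}
  isRelLowerSet_faces := by
    rintro σ ⟨hne, hd⟩
    refine ⟨hne, fun τ hτ hτne => ⟨hτne, lt_of_le_of_lt ?_ hd⟩⟩
    exact Metric.diam_mono (by exact_mod_cast hτ) σ.finite_toSet.isBounded
  singleton_mem v := by simpa using hr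

theorem rips_mono {r s : ℝ} (hr : 0 < r) (h : r ≤ s) :
    rips X r hr ≤ rips X s (hr.trans_le h) :=
  fun _ hσ => ⟨hσ.1, hσ.2.trans_le h⟩

/-- The fundamental group `π₁(Rips(X, r), x₀)` of the geometric realization. -/
abbrev RipsPi1 (x₀ : X) (r : ℝ) (hr : 0 < r) : Type _ :=
  FundamentalGroup (Realization (rips X r hr)) (Realization.vertex _ x₀)

/-- The bonding homomorphism `π₁(Rips(X, r), x₀) → π₁(Rips(X, s), x₀)` for `r ≤ s`. -/
def bonding (x₀ : X) {r s : ℝ} (hr : 0 < r) (h : r ≤ s) :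
    RipsPi1 x₀ r hr →* RipsPi1 x₀ s (hr.trans_le h) :=
  FundamentalGroup.map (Realization.inclusion (rips_mono hr h)) (Realization.vertex _ x₀)

/-- `p > 0` is a left critical value: for all small enough `ε > 0` the bonding map from
`p - ε` to `p` is not an isomorphism. -/
def IsLeftCritical (x₀ : X) (p : ℝ) : Prop :=
  0 < p ∧ ∃ δ > 0, ∀ ε : ℝ, 0 < ε → ε < δ → ∀ h : 0 < p - ε, ∀ hle : p - ε ≤ p,
    ¬ Function.Bijective (bonding x₀ h hle)

/-- `p > 0` is a right critical value: for all `ε > 0` the bonding map from `p` to `p + ε` is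
not an isomorphism. -/
def IsRightCritical (x₀ : X) (p : ℝ) : Prop :=
  ∃ hp : 0 < p, ∀ ε : ℝ, 0 < ε → ∀ hle : p ≤ p + ε,
    ¬ Function.Bijective (bonding x₀ hp hle)

/-- `p` is a critical value of the `π₁`-persistence of `(X, x₀)` via open Rips complexes. -/
def IsCriticalValue (x₀ : X) (p : ℝ) : Prop :=
  IsLeftCritical x₀ p ∨ IsRightCritical x₀ p

/-! ### Geodesics, lassos and the subgroups of `π₁(X, x₀)` they generate -/

/-- Any two points `x, y` are joined by an isometric embedding of `[0, dist x y]`. -/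
def IsGeodesicSpace (X : Type*) [MetricSpace X] : Prop :=
  ∀ x y : X, ∃ f : ℝ → X, f 0 = x ∧ f (dist x y) = y ∧
    ∀ s ∈ Set.Icc 0 (dist x y), ∀ t ∈ Set.Icc 0 (dist x y), dist (f s) (f t) = |s - t|

/-- The length of a path (possibly infinite). -/
def pathLength {x y : X} (γ : Path x y) : ENNReal :=
  eVariationOn γ Set.univ

/-- The class in `π₁(X, x₀)` of the lasso `α * β * α⁻`. -/
def lassoClass {x₀ y : X} (α : Path x₀ y) (β : Path y y) : FundamentalGroup X x₀ :=
  FundamentalGroup.fromPath (Path.Homotopic.Quotient.mk ((α.trans β).trans α.symm))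

/-- `L(X, r, π₁)`: the subgroup generated by the `l`-lassos with `l < r`. -/
def lengthSubgroup (x₀ : X) (r : ℝ) : Subgroup (FundamentalGroup X x₀) :=
  Subgroup.closure {g | ∃ (y : X) (α : Path x₀ y) (β : Path y y),
    pathLength β < ENNReal.ofReal r ∧ g = lassoClass α β}

/-- `S(X, r, π₁)`: the subgroup generated by the lassos `α * β * α⁻` for which `β` lies in some
closed ball of radius `d < r`. -/
def spanierSubgroup (x₀ : X) (r : ℝ) : Subgroup (FundamentalGroup X x₀) :=
  Subgroup.closure {g | ∃ (y : X) (α : Path x₀ y) (β : Path y y) (w : X) (d : ℝ),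
    d < r ∧ Set.range β ⊆ Metric.closedBall w d ∧ g = lassoClass α β}

/-- A geodesic circle of length `l`: an isometric embedding of the circle of circumference `l > 0`
with its arc-length metric. -/
def IsGeodesicCircle (l : ℝ) (f : AddCircle l → X) : Prop :=
  0 < l ∧ Isometry f

/-- The loop `β` traverses a geodesic circle of length `l` once at constant speed. -/
def IsGeodesicCircleLoop (l : ℝ) {y : X} (β : Path y y) : Prop :=
  ∃ f : AddCircle l → X, IsGeodesicCircle l f ∧
    ∀ t : unitInterval, β t = f ((l * (t : ℝ) : ℝ) : AddCircle l)

/-- The classes in `π₁(X, x₀)` of the geodesic `l`-lassos `α * β * α⁻`: `β` is a geodesic circle of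
length `l` and `α` is a path from `x₀` to a point of it. -/
def geodesicLassoClasses (x₀ : X) (l : ℝ) : Set (FundamentalGroup X x₀) :=
  {g | ∃ (y : X) (α : Path x₀ y) (β : Path y y), IsGeodesicCircleLoop l β ∧ g = lassoClass α β}

/-- `q < p` are consecutive critical values. -/
def AreConsecutiveCritical (x₀ : X) (q p : ℝ) : Prop :=
  q < p ∧ IsCriticalValue x₀ q ∧ IsCriticalValue x₀ p ∧
    ∀ c, q < c → c < p → ¬ IsCriticalValue x₀ c

end RipsPersistence

end

/-
The normal subgroups of `π₁(X)` are the kernels of multiplicative functions of path classes with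
values in a group, called transports below. A map `X → Rips(X, r)` that moves points very little
identifies `π₁(Rips(X, r))` with `π₁(X) / S(3r/2)`: a triangle in `Rips(X, r)` has a geodesic
boundary shorter than `3r`, so a transport that is trivial on such loops extends to `Rips(X, r)`.
Hence the critical values are the scales at which `S` jumps.

By Arzelà–Ascoli finitely many loops distinguish the groups `S(s)` for `s` in a compact set of
positive scales, so `S` jumps finitely often there, and only from the right. At a jump, loops that
become trivial just after `3q` converge to a loop of length at most `3q` that is not yet trivial. If
two of its points were closer than along the loop, a geodesic between them would split it into
two shorter loops; so it is a geodesic circle of length `3q`.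

Balls do not help to decompose short loops: a transport that is trivial on loops shorter than `3q`
can be replaced, through the Rips complex, by one that is also trivial on loops in balls of radius
less than `3q/2`, without changing its values on Lipschitz paths.
-/

noncomputable section

namespace RipsPersistence

open scoped Topology NNReal

local notation "I" => unitInterval

local notation "⟪" γ "⟫" => Path.Homotopic.Quotient.mk γ

section Realization

variable {ι Z : Type*} [TopologicalSpace Z] {K : AbstractSimplicialComplex ι}

theorem support_nonempty_of_sum_eq_one {w : ι →₀ ℝ} (hw : (w.sum fun _ x => x) = 1) :
    w.support.Nonempty := by
  rw [Finsupp.support_nonempty_iff]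
  rintro rfl
  simp at hw

theorem continuous_realization_iff {f : Realization K → Z} :
    Continuous f ↔ ∀ σ ∈ K.faces, Continuous fun w : ClosedSimplex K σ => f w.point := by
  simp only [continuous_def, isOpen_realization_iff]
  exact ⟨fun h σ hσ U hU => h U hU σ hσ, fun h U hU σ hσ => h σ hσ U hU⟩

theorem ClosedSimplex.continuous_weight {σ : Finset ι} (v : ι) :
    Continuous fun w : ClosedSimplex K σ => w.point.weight v :=
  (continuous_apply v).comp continuous_induced_dom

theorem ClosedSimplex.continuous_point {σ : Finset ι} (hσ : σ ∈ K.faces) :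
    Continuous (ClosedSimplex.point : ClosedSimplex K σ → Realization K) :=
  continuous_realization_iff.1 continuous_id σ hσ

namespace Realization

theorem support_nonempty (w : Realization K) : w.weight.support.Nonempty :=
  support_nonempty_of_sum_eq_one w.sum_eq_one

@[simp]
theorem support_vertex (v : ι) : (vertex K v).weight.support = {v} :=
  Finsupp.support_single v one_ne_zero

/-- The point of the realization with given barycentric coordinates supported on a simplex. -/
def ofSupportSubset {τ : Finset ι} (hτ : τ ∈ K.faces) (w : ι →₀ ℝ) (hw : ∀ v, 0 ≤ w v)
    (hsum : (w.sum fun _ x => x) = 1) (hsub : w.support ⊆ τ) : Realization K where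
  weight := w
  nonneg := hw
  sum_eq_one := hsum
  support_mem := (K.isRelLowerSet_faces hτ).2 hsub (support_nonempty_of_sum_eq_one hsum)

theorem continuous_weightedSum (a : ι → ℝ) :
    Continuous fun w : Realization K => w.weight.sum fun v x => a v * x := by
  refine continuous_realization_iff.2 fun σ _ => ?_
  have sum_over_face (w : ClosedSimplex K σ) : (w.point.weight.sum fun v x => a v * x) =
      ∑ v ∈ σ, a v * w.point.weight v :=
    Finsupp.sum_of_support_subset _ w.support_subset _ fun v _ => mul_zero _
  simp only [sum_over_face]
  exact continuous_finsetSum _ fun v _ =>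
    continuous_const.mul (ClosedSimplex.continuous_weight v)

theorem continuous_weight (v : ι) : Continuous fun w : Realization K => w.weight v :=
  continuous_realization_iff.2 fun _ _ => ClosedSimplex.continuous_weight v

/-- The open star of a vertex: the points with a nonzero coordinate at that vertex. -/
def openStar (K : AbstractSimplicialComplex ι) (v : ι) : Set (Realization K) :=
  {w | v ∈ w.weight.support}

theorem mem_openStar {v : ι} {w : Realization K} : w ∈ openStar K v ↔ 0 < w.weight v :=
  Finsupp.mem_support_iff.trans (w.nonneg v).lt_iff_ne'.symm

theorem vertex_mem_openStar (v : ι) : vertex K v ∈ openStar K v := by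
  simp [mem_openStar, vertex]

theorem isOpen_openStar (v : ι) : IsOpen (openStar K v) := by
  simpa only [openStar, Finsupp.mem_support_iff] using
    isOpen_ne_fun (continuous_weight v) continuous_const

theorem isClosed_support_subset {f : Z → Realization K}
    (hf : ∀ v, Continuous fun z => (f z).weight v) (σ : Finset ι) :
    IsClosed {z | (f z).weight.support ⊆ σ} := by
  have eq_iInter : {z | (f z).weight.support ⊆ σ} =
      ⋂ v ∈ {v | v ∉ σ}, {z | (f z).weight v = 0} := by
    ext z
    simp only [Set.mem_ofPred_eq, Set.mem_iInter, Finset.subset_iff, Finsupp.mem_support_iff]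
    exact forall_congr' fun v => not_imp_comm
  rw [eq_iInter]
  exact isClosed_biInter fun v _ => isClosed_eq (hf v) continuous_const

theorem continuous_of_support_subset {f : Z → Realization K} {V : Finset ι}
    (hV : ∀ z, (f z).weight.support ⊆ V) (hf : ∀ v, Continuous fun z => (f z).weight v) :
    Continuous f := by
  let S : Set (Finset ι) := {σ | σ ⊆ V ∧ σ ∈ K.faces}
  have : Finite S := V.powerset.finite_toSet.subset fun σ hσ => by simpa using hσ.1
  refine (locallyFinite_of_finite fun σ : S => {z | (f z).weight.support ⊆ σ.1}).continuous
    (Set.eq_univ_of_forall fun z => Set.mem_iUnion.2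
      ⟨⟨(f z).weight.support, hV z, (f z).support_mem⟩, Finset.Subset.refl _⟩)
    (fun σ => isClosed_support_subset hf σ.1) fun σ => ?_
  rw [continuousOn_iff_continuous_domRestrict]
  have hcont : Continuous fun z : {z | (f z).weight.support ⊆ σ.1} =>
      (⟨f z.1, z.2⟩ : ClosedSimplex K σ.1) :=
    continuous_induced_rng.2 (continuous_pi fun v => (hf v).comp continuous_subtype_val)
  exact (ClosedSimplex.continuous_point σ.2.2).comp hcont

theorem continuous_of_locallyFinite {f : Z → Realization K}
    (hfin : LocallyFinite fun v => {z | v ∈ (f z).weight.support})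
    (hf : ∀ v, Continuous fun z => (f z).weight v) : Continuous f := by
  refine continuous_iff_continuousAt.2 fun z => ?_
  obtain ⟨U, hU, hUfin⟩ := hfin z
  refine ContinuousOn.continuousAt (s := U) ?_ hU
  rw [continuousOn_iff_continuous_domRestrict]
  refine continuous_of_support_subset (V := hUfin.toFinset) (fun y v hv => ?_)
    fun v => (hf v).comp continuous_subtype_val
  exact hUfin.mem_toFinset.2 ⟨y, hv, y.2⟩

theorem mul_weight_le_weightedSum {a : ι → ℝ} (ha : ∀ v, 0 ≤ a v) (w : Realization K) {v : ι}
    (hv : v ∈ w.weight.support) : a v * w.weight v ≤ w.weight.sum fun v x => a v * x :=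
  Finset.single_le_sum (f := fun v => a v * w.weight v)
    (fun u _ => mul_nonneg (ha u) (w.nonneg u)) hv

theorem exists_forall_support_subset [CompactSpace Z] {f : Z → Realization K}
    (hf : Continuous f) : ∃ V : Finset ι, ∀ z, (f z).weight.support ⊆ V := by
  by_contra! hunbounded
  have hinf : (⋃ z, ((f z).weight.support : Set ι)).Infinite := fun hfin => by
    obtain ⟨z, hz⟩ := hunbounded hfin.toFinset
    exact hz fun v hv => hfin.mem_toFinset.2 (Set.mem_iUnion.2 ⟨z, hv⟩)
  let e := hinf.natEmbedding
  choose z hz using fun n => Set.mem_iUnion.1 (e n).2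
  have he : Function.Injective fun n => (e n : ι) := Subtype.val_injective.comp e.injective
  -- The weighted sum with these coefficients is continuous, yet it is at least `n` at `f (z n)`.
  let a : ι → ℝ := Function.extend (fun n => (e n : ι)) (fun n => n / (f (z n)).weight (e n)) 0
  have ha (n : ℕ) : a (e n) = n / (f (z n)).weight (e n) := he.extend_apply _ _ n
  have ha_nonneg (v : ι) : 0 ≤ a v := by
    by_cases h : ∃ n, (e n : ι) = v
    · obtain ⟨n, rfl⟩ := h
      exact (ha n).symm ▸ div_nonneg n.cast_nonneg ((f (z n)).nonneg _)
    · exact (Function.extend_apply' (f := fun n => (e n : ι)) _ (0 : ι → ℝ) v h).ge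
  obtain ⟨C, hC⟩ := (isCompact_range ((continuous_weightedSum a).comp hf)).bddAbove
  obtain ⟨n, hn⟩ := exists_nat_gt C
  have hle := mul_weight_le_weightedSum ha_nonneg (f (z n)) (hz n)
  rw [ha, div_mul_cancel₀ _ (Finsupp.mem_support_iff.1 (hz n))] at hle
  exact absurd (hle.trans (hC (Set.mem_range_self (z n)))) (not_le.2 hn)

/-- Two points of the realization are contiguous if a common closed simplex contains them; they are
then the end points of a straight segment. -/
def Contiguous (a b : Realization K) : Prop :=
  ∃ τ ∈ K.faces, a.weight.support ⊆ τ ∧ b.weight.support ⊆ τ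

theorem Contiguous.symm {a b : Realization K} (h : Contiguous a b) : Contiguous b a :=
  let ⟨τ, hτ, ha, hb⟩ := h
  ⟨τ, hτ, hb, ha⟩

theorem Contiguous.refl (a : Realization K) : Contiguous a a :=
  ⟨_, a.support_mem, Finset.Subset.refl _, Finset.Subset.refl _⟩

theorem contiguous_vertex {a : Realization K} {v : ι} (h : a ∈ openStar K v) :
    Contiguous a (vertex K v) :=
  ⟨_, a.support_mem, Finset.Subset.refl _, by
    rwa [support_vertex, Finset.singleton_subset_iff]⟩

theorem support_lerp_subset {w w' : ι →₀ ℝ} {τ : Finset ι} (t : ℝ) (hw : w.support ⊆ τ)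
    (hw' : w'.support ⊆ τ) : ((1 - t) • w + t • w').support ⊆ τ := by
  classical
  exact Finsupp.support_add.trans
    (Finset.union_subset (Finsupp.support_smul.trans hw) (Finsupp.support_smul.trans hw'))

/-- The point dividing the segment between two contiguous points in the ratio `t : 1 - t`. -/
def lerp {a b : Realization K} (h : Contiguous a b) (t : I) : Realization K :=
  ofSupportSubset h.choose_spec.1 ((1 - (t : ℝ)) • a.weight + (t : ℝ) • b.weight)
    (fun v => add_nonneg (mul_nonneg (unitInterval.one_minus_nonneg t) (a.nonneg v))
      (mul_nonneg (unitInterval.nonneg t) (b.nonneg v)))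
    (by
      classical
      rw [Finsupp.sum_add_index' (fun _ => rfl) (fun _ _ _ => rfl),
        Finsupp.sum_smul_index (fun _ => rfl), Finsupp.sum_smul_index (fun _ => rfl),
        ← Finsupp.mul_sum, ← Finsupp.mul_sum, a.sum_eq_one, b.sum_eq_one]
      ring)
    (support_lerp_subset _ h.choose_spec.2.1 h.choose_spec.2.2)

theorem weight_lerp {a b : Realization K} (h : Contiguous a b) (t : I) :
    (lerp h t).weight = (1 - (t : ℝ)) • a.weight + (t : ℝ) • b.weight := rfl

theorem lerp_zero {a b : Realization K} (h : Contiguous a b) : lerp h 0 = a :=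
  Realization.ext (by simp [weight_lerp])

theorem lerp_one {a b : Realization K} (h : Contiguous a b) : lerp h 1 = b :=
  Realization.ext (by simp [weight_lerp])

theorem lerp_self {a : Realization K} (h : Contiguous a a) (t : I) : lerp h t = a :=
  Realization.ext (by rw [weight_lerp, ← add_smul, sub_add_cancel, one_smul])

theorem continuous_lerp [CompactSpace Z] {f g : Z → Realization K} (hf : Continuous f)
    (hg : Continuous g) (h : ∀ z, Contiguous (f z) (g z)) :
    Continuous fun x : I × Z => lerp (h x.2) x.1 := by
  classical
  obtain ⟨V, hV⟩ := exists_forall_support_subset hf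
  obtain ⟨W, hW⟩ := exists_forall_support_subset hg
  refine continuous_of_support_subset (V := V ∪ W) (fun x => support_lerp_subset _
    ((hV _).trans Finset.subset_union_left) ((hW _).trans Finset.subset_union_right)) fun v => ?_
  have ht : Continuous fun x : I × Z => (x.1 : ℝ) := continuous_subtype_val.comp continuous_fst
  exact ((continuous_const.sub ht).mul (((continuous_weight v).comp hf).comp continuous_snd)).add
    (ht.mul (((continuous_weight v).comp hg).comp continuous_snd))

/-- The straight segment between contiguous points. -/
def segPath {a b : Realization K} (h : Contiguous a b) : Path a b where
  toFun := lerp h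
  continuous_toFun := continuous_of_support_subset
    (fun _ => support_lerp_subset _ h.choose_spec.2.1 h.choose_spec.2.2) fun v => by
      simp only [weight_lerp, Finsupp.add_apply, Finsupp.smul_apply, smul_eq_mul]
      fun_prop
  source' := lerp_zero h
  target' := lerp_one h

/-- The homotopy class of the straight segment between contiguous points. -/
def seg {a b : Realization K} (h : Contiguous a b) : Path.Homotopic.Quotient a b :=
  ⟪segPath h⟫

theorem homotopic_of_contiguous {a b : Realization K} {f g : Path a b}
    (h : ∀ t, Contiguous (f t) (g t)) : f.Homotopic g :=
  ⟨{ toFun := fun x => lerp (h x.2) x.1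
     continuous_toFun := continuous_lerp f.continuous g.continuous h
     map_zero_left := fun t => lerp_zero _
     map_one_left := fun t => lerp_one _
     prop' := by
      have lerp_eq_left : ∀ {x y : Realization K} (hxy : Contiguous x y) (t : I), y = x →
          lerp hxy t = x := by
        rintro x _ hxy t rfl
        exact lerp_self hxy t
      rintro t _ (rfl | rfl)
      · exact lerp_eq_left (h 0) t (g.source.trans f.source.symm)
      · exact lerp_eq_left (h 1) t (g.target.trans f.target.symm) }⟩

theorem support_segPath_subset {a b : Realization K} (h : Contiguous a b) {τ : Finset ι}
    (ha : a.weight.support ⊆ τ) (hb : b.weight.support ⊆ τ) (t : I) :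
    (segPath h t).weight.support ⊆ τ :=
  support_lerp_subset _ ha hb

theorem contiguous_segPath_left {a b : Realization K} (h : Contiguous a b) (t : I) :
    Contiguous a (segPath h t) := by
  have ⟨τ, hτ, ha, hb⟩ := h
  exact ⟨τ, hτ, ha, support_segPath_subset h ha hb t⟩

theorem contiguous_segPath_right {a b : Realization K} (h : Contiguous a b) (t : I) :
    Contiguous b (segPath h t) := by
  have ⟨τ, hτ, ha, hb⟩ := h
  exact ⟨τ, hτ, hb, support_segPath_subset h ha hb t⟩

theorem segPath_mem_openStar {a b : Realization K} (h : Contiguous a b) {v : ι}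
    (ha : a ∈ openStar K v) (hb : b ∈ openStar K v) (t : I) : segPath h t ∈ openStar K v :=
  mem_openStar.2 (convex_Ioi (0 : ℝ) (mem_openStar.1 ha) (mem_openStar.1 hb)
    (unitInterval.one_minus_nonneg t) (unitInterval.nonneg t) (sub_add_cancel 1 (t : ℝ)))

theorem segPath_mem_openStar_left {a b : Realization K} (h : Contiguous a b) {v : ι}
    (ha : a ∈ openStar K v) {t : I} (ht : t < 1) : segPath h t ∈ openStar K v :=
  mem_openStar.2 (add_pos_of_pos_of_nonneg (mul_pos (sub_pos.2 ht) (mem_openStar.1 ha))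
    (mul_nonneg (unitInterval.nonneg t) (b.nonneg v)))

theorem segPath_mem_openStar_right {a b : Realization K} (h : Contiguous a b) {v : ι}
    (hb : b ∈ openStar K v) {t : I} (ht : 0 < t) : segPath h t ∈ openStar K v :=
  mem_openStar.2 (add_pos_of_nonneg_of_pos
    (mul_nonneg (unitInterval.one_minus_nonneg t) (a.nonneg v))
    (mul_pos ht (mem_openStar.1 hb)))

theorem forall_trans_apply {Y Y' : Type*} [TopologicalSpace Y] [TopologicalSpace Y']
    {P : Y → Y' → Prop} {x y z : Y} {x' y' z' : Y'} {γ : Path x y} {δ : Path y z}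
    {γ' : Path x' y'} {δ' : Path y' z'} (h : ∀ t, P (γ t) (γ' t)) (h' : ∀ t, P (δ t) (δ' t))
    (t : I) : P (γ.trans δ t) (γ'.trans δ' t) := by
  rw [Path.trans_apply, Path.trans_apply]
  split_ifs
  exacts [h _, h' _]

theorem mk_eq_seg_trans_of_contiguous {a b a' b' : Realization K} {f : Path a b} {g : Path a' b'}
    (h : ∀ t, Contiguous (f t) (g t)) (ha : Contiguous a a') (hb : Contiguous b' b) :
    ⟪f⟫ = (seg ha).trans (⟪g⟫.trans (seg hb)) := by
  have homotopic : ((Path.refl a).trans (f.trans (Path.refl b))).Homotopic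
      ((segPath ha).trans (g.trans (segPath hb))) :=
    homotopic_of_contiguous (forall_trans_apply (contiguous_segPath_left ha)
      (forall_trans_apply h (contiguous_segPath_right hb)))
  simpa only [seg, Path.Homotopic.Quotient.mk_trans, Path.Homotopic.Quotient.mk_refl,
    Path.Homotopic.Quotient.refl_trans, Path.Homotopic.Quotient.trans_refl] using
    Path.Homotopic.Quotient.eq.2 homotopic

theorem mk_eq_seg_of_support_subset {a b : Realization K} {f : Path a b} {τ : Finset ι}
    (hτ : τ ∈ K.faces) (h : ∀ t, (f t).weight.support ⊆ τ) (hab : Contiguous a b) :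
    ⟪f⟫ = seg hab := by
  have ha : a.weight.support ⊆ τ := by simpa using h 0
  have hb : b.weight.support ⊆ τ := by simpa using h 1
  exact Path.Homotopic.Quotient.eq.2
    (homotopic_of_contiguous fun t => ⟨τ, hτ, h t, support_segPath_subset _ ha hb t⟩)

theorem seg_symm {a b : Realization K} (h : Contiguous a b) : (seg h).symm = seg h.symm := by
  obtain ⟨τ, hτ, ha, hb⟩ := id h
  rw [seg, ← Path.Homotopic.Quotient.mk_symm]
  exact mk_eq_seg_of_support_subset (f := (segPath h).symm) hτ
    (fun _ => support_segPath_subset h ha hb _) h.symm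

theorem seg_self {a : Realization K} (h : Contiguous a a) :
    seg h = Path.Homotopic.Quotient.refl a := by
  rw [← Path.Homotopic.Quotient.mk_refl]
  exact (mk_eq_seg_of_support_subset a.support_mem (fun _ => Finset.Subset.refl _) h).symm

theorem seg_trans_seg {a b c : Realization K} {τ : Finset ι} (hτ : τ ∈ K.faces)
    (ha : a.weight.support ⊆ τ) (hb : b.weight.support ⊆ τ) (hc : c.weight.support ⊆ τ)
    (hab : Contiguous a b) (hbc : Contiguous b c) (hac : Contiguous a c) :
    (seg hab).trans (seg hbc) = seg hac := by
  refine mk_eq_seg_of_support_subset (f := (segPath hab).trans (segPath hbc)) hτ (fun t => ?_) hac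
  rw [Path.trans_apply]
  split_ifs
  exacts [support_segPath_subset _ ha hb _, support_segPath_subset _ hb hc _]

theorem mk_eq_seg_trans_seg_of_openStar {a b : Realization K} {f : Path a b} {v : ι}
    (h : ∀ t, f t ∈ openStar K v) (ha : Contiguous a (vertex K v))
    (hb : Contiguous (vertex K v) b) : ⟪f⟫ = (seg ha).trans (seg hb) := by
  rw [mk_eq_seg_trans_of_contiguous (g := Path.refl (vertex K v))
    (fun t => contiguous_vertex (h t)) ha hb, Path.Homotopic.Quotient.mk_refl,
    Path.Homotopic.Quotient.refl_trans]

end Realization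

end Realization

section PathClass

variable {Y Z : Type*} [TopologicalSpace Y] [TopologicalSpace Z]

open Path.Homotopic.Quotient (mk_symm mk_trans mk_map refl_trans symm_trans trans_symm trans_assoc)

theorem pathClass_symm_trans_cancel {x y z : Y} (p : Path.Homotopic.Quotient x y)
    (q : Path.Homotopic.Quotient y z) : p.symm.trans (p.trans q) = q := by
  rw [← trans_assoc, symm_trans, refl_trans]

theorem pathClass_trans_symm_cancel {x y z : Y} (p : Path.Homotopic.Quotient x y)
    (q : Path.Homotopic.Quotient x z) : p.trans (p.symm.trans q) = q := by
  rw [← trans_assoc, trans_symm, refl_trans]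

theorem pathClass_map_trans {x y z : Y} (p : Path.Homotopic.Quotient x y)
    (q : Path.Homotopic.Quotient y z) (f : C(Y, Z)) :
    (p.trans q).map f = (p.map f).trans (q.map f) := by
  induction p with | mk p => ?_
  induction q with | mk q => ?_
  rw [← mk_trans, ← mk_map, Path.map_trans]
  rfl

theorem mk_subpath_trans {x y : Y} (γ : Path x y) (a b c : I) :
    ⟪γ.subpath a b⟫.trans ⟪γ.subpath b c⟫ = ⟪γ.subpath a c⟫ := by
  rw [← mk_trans]
  exact Path.Homotopic.Quotient.eq.2 ⟨Path.Homotopy.subpathTransSubpath γ a b c⟩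

theorem eventually_subpath_mem {x y : Y} (γ : Path x y) {t : I} {V : Set Y} (hV : V ∈ 𝓝 (γ t)) :
    ∀ᶠ ab in 𝓝 (t, t), ∀ s, γ.subpath ab.1 ab.2 s ∈ V := by
  have hpre : γ ⁻¹' V ∈ 𝓝 t := γ.continuous.continuousAt.preimage_mem_nhds hV
  have hnhds := Set.ordConnectedComponent_mem_nhds.2 hpre
  filter_upwards [prod_mem_nhds hnhds hnhds] with ab ⟨ha, hb⟩ s
  have hmem : γ.subpath ab.1 ab.2 s ∈ γ '' Set.uIcc ab.1 ab.2 := by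
    rw [← Path.range_subpath]
    exact Set.mem_range_self s
  obtain ⟨u, hu, hus⟩ := hmem
  have hu_mem : u ∈ γ ⁻¹' V :=
    Set.ordConnectedComponent_subset (Set.OrdConnected.uIcc_subset inferInstance ha hb hu)
  exact hus ▸ hu_mem

theorem eventually_dist_subpath_lt {X : Type*} [PseudoMetricSpace X] {x y : X} (γ : Path x y)
    (t : I) {η : ℝ} (hη : 0 < η) :
    ∀ᶠ ab in 𝓝 (t, t), ∀ s, dist (γ.subpath ab.1 ab.2 s) (γ ab.1) < η := by
  filter_upwards [eventually_subpath_mem γ (Metric.ball_mem_nhds (γ t) (half_pos hη))] with ab h s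
  have hstart := h 0
  rw [Path.source] at hstart
  linarith [dist_triangle_right (γ.subpath ab.1 ab.2 s) (γ ab.1) (γ t), Metric.mem_ball.1 (h s),
    Metric.mem_ball.1 hstart]

theorem unitInterval_rel_zero_one {P : I → I → Prop}
    (htrans : ∀ a b c, P a b → P b c → P a c)
    (hloc : ∀ t, ∀ᶠ ab in 𝓝 (t, t), P ab.1 ab.2) : P 0 1 := by
  simp only [nhds_prod_eq, Filter.eventually_prod_self_iff] at hloc
  choose U hU hP using hloc
  obtain ⟨t, ht_zero, hmono, ⟨n, hn⟩, ht⟩ := exists_monotone_Icc_subset_open_cover_unitInterval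
    (c := fun s => interior (U s)) (fun _ => isOpen_interior)
    (fun s _ => Set.mem_iUnion.2 ⟨s, mem_interior_iff_mem_nhds.2 (hU s)⟩)
  have hstep (k : ℕ) : P (t k) (t (k + 1)) := by
    obtain ⟨s, hs⟩ := ht k
    have hle := hmono k.le_succ
    exact hP s _ (interior_subset (hs (Set.left_mem_Icc.2 hle))) _
      (interior_subset (hs (Set.right_mem_Icc.2 hle)))
  have hiter : ∀ k, P (t 0) (t (k + 1)) := fun k => by
    induction k with
    | zero => exact hstep 0
    | succ k ih => exact htrans _ _ _ ih (hstep (k + 1))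
  simpa only [ht_zero, hn (n + 1) n.le_succ] using hiter n

theorem pathClass_of_eventually_subpath {P : ∀ {x y : Y}, Path.Homotopic.Quotient x y → Prop}
    (htrans : ∀ {x y z : Y} {p : Path.Homotopic.Quotient x y} {q : Path.Homotopic.Quotient y z},
      P p → P q → P (p.trans q))
    {x y : Y} (γ : Path x y) (hloc : ∀ t, ∀ᶠ ab in 𝓝 (t, t), P ⟪γ.subpath ab.1 ab.2⟫) :
    P ⟪γ⟫ := by
  have hzero_one : P ⟪γ.subpath 0 1⟫ := unitInterval_rel_zero_one
    (P := fun a b => P ⟪γ.subpath a b⟫)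
    (fun a b c hab hbc => mk_subpath_trans γ a b c ▸ htrans hab hbc) hloc
  have of_cast : ∀ {x' y' : Y} (hx : x' = x) (hy : y' = y), P ⟪γ.cast hx hy⟫ → P ⟪γ⟫ := by
    rintro _ _ rfl rfl h
    exact h
  rw [Path.subpath_zero_one] at hzero_one
  exact of_cast _ _ hzero_one

end PathClass

/-- A functor from the fundamental groupoid of `Y` to the group `Q`. Composition of paths is sent to
the product in the reverse order, as in the multiplication of `FundamentalGroup`. -/
structure PathTransport (Y Q : Type*) [TopologicalSpace Y] [Group Q] where
  map {x y : Y} : Path.Homotopic.Quotient x y → Q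
  map_trans {x y z : Y} (p : Path.Homotopic.Quotient x y) (q : Path.Homotopic.Quotient y z) :
    map (p.trans q) = map q * map p

namespace PathTransport

variable {Y Q : Type*} [TopologicalSpace Y] [Group Q]

variable (h : PathTransport Y Q)

theorem map_refl (x : Y) : h.map (Path.Homotopic.Quotient.refl x) = 1 := by
  have hmul := h.map_trans (.refl x) (.refl x)
  rw [Path.Homotopic.Quotient.refl_trans] at hmul
  exact left_eq_mul.1 hmul

theorem map_symm {x y : Y} (p : Path.Homotopic.Quotient x y) : h.map p.symm = (h.map p)⁻¹ := by
  rw [eq_inv_iff_mul_eq_one, ← h.map_trans, Path.Homotopic.Quotient.trans_symm, h.map_refl]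

theorem map_mk_trans {x y z : Y} (γ : Path x y) (δ : Path y z) :
    h.map ⟪γ.trans δ⟫ = h.map ⟪δ⟫ * h.map ⟪γ⟫ := by
  rw [Path.Homotopic.Quotient.mk_trans, h.map_trans]

theorem map_mk_symm {x y : Y} (γ : Path x y) : h.map ⟪γ.symm⟫ = (h.map ⟪γ⟫)⁻¹ := by
  rw [Path.Homotopic.Quotient.mk_symm, h.map_symm]

theorem map_mk_cast {x y x' y' : Y} (γ : Path x y) (hx : x' = x) (hy : y' = y) :
    h.map ⟪γ.cast hx hy⟫ = h.map ⟪γ⟫ := by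
  subst hx hy
  rfl

theorem map_mk_eq_of_subpath {x y : Y} (γ : Path x y) (t : I) :
    h.map ⟪γ⟫ = h.map ⟪γ.subpath t 1⟫ * h.map ⟪γ.subpath 0 t⟫ := by
  rw [← h.map_trans, mk_subpath_trans, Path.subpath_zero_one, h.map_mk_cast]

theorem eq_of_eventually_subpath {h h' : PathTransport Y Q} {x y : Y} (γ : Path x y)
    (hloc : ∀ t, ∀ᶠ ab in 𝓝 (t, t), h.map ⟪γ.subpath ab.1 ab.2⟫ = h'.map ⟪γ.subpath ab.1 ab.2⟫) :
    h.map ⟪γ⟫ = h'.map ⟪γ⟫ :=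
  pathClass_of_eventually_subpath (P := fun p => h.map p = h'.map p)
    (fun hp hq => by rw [h.map_trans, h'.map_trans, hp, hq]) γ hloc

/-- The homomorphism that a transport induces on the fundamental group. -/
def hom (x₀ : Y) : FundamentalGroup Y x₀ →* Q where
  toFun g := h.map (FundamentalGroup.toPath g)
  map_one' := h.map_refl x₀
  map_mul' _ _ := h.map_trans _ _

end PathTransport

section Covering

open Realization

variable {ι Q : Type*} [Group Q] {K : AbstractSimplicialComplex ι}

/-- A function on pairs of vertices that is multiplicative on the simplices of `K`, with the order
of factors of `PathTransport`. -/
def IsEdgeCocycle (K : AbstractSimplicialComplex ι) (c : ι → ι → Q) : Prop :=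
  ∀ τ ∈ K.faces, ∀ u ∈ τ, ∀ v ∈ τ, ∀ w ∈ τ, c v w * c u v = c u w

theorem IsEdgeCocycle.self {c : ι → ι → Q} (hc : IsEdgeCocycle K c) (v : ι) : c v v = 1 := by
  have hv := Finset.mem_singleton_self v
  exact mul_eq_left.1 (hc {v} (K.singleton_mem v) v hv v hv v hv)

/-- A choice of a vertex of the smallest simplex that contains a given point. -/
def someVertex (w : Realization K) : ι :=
  w.support_nonempty.choose

theorem someVertex_mem (w : Realization K) : someVertex w ∈ w.weight.support :=
  w.support_nonempty.choose_spec

theorem someVertex_vertex (v : ι) : someVertex (vertex K v) = v := by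
  simpa using someVertex_mem (vertex K v)

section Monodromy

variable [TopologicalSpace Q] [DiscreteTopology Q] {c : ι → ι → Q}

/-- The bundle with discrete fibre `Q`, trivial over the open stars, glued by a cocycle. -/
def cocycleBundle (hc : IsEdgeCocycle K c) : FiberBundleCore ι (Realization K) Q where
  baseSet := openStar K
  isOpen_baseSet := isOpen_openStar
  indexAt := someVertex
  mem_baseSet_at := someVertex_mem
  coordChange u v _ g := c u v * g
  coordChange_self v _ _ g := by rw [hc.self, one_mul]
  continuousOn_coordChange u v :=
    ((continuous_of_discreteTopology (f := fun g : Q => c u v * g)).comp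
      continuous_snd).continuousOn
  coordChange_comp u v w x hx g := by
    rw [← mul_assoc, hc x.weight.support x.support_mem u hx.1.1 v hx.1.2 w hx.2]

theorem isCoveringMap_cocycleBundle (hc : IsEdgeCocycle K c) :
    IsCoveringMap (cocycleBundle hc).proj :=
  FiberBundle.isCoveringMap (F := Q) (E := (cocycleBundle hc).Fiber)

/-- The action of the path classes of the realization on the fibres of the covering glued by the
cocycle `c`, each fibre being identified with `Q` in the chart of its chosen vertex. -/
def cocycleMonodromy (hc : IsEdgeCocycle K c) {a b : Realization K}
    (p : Path.Homotopic.Quotient a b) (g : Q) : Q :=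
  ((isCoveringMap_cocycleBundle hc).monodromy p ⟨⟨a, g⟩, rfl⟩).1.2

theorem cocycleMonodromy_trans (hc : IsEdgeCocycle K c) {a b d : Realization K}
    (p : Path.Homotopic.Quotient a b) (q : Path.Homotopic.Quotient b d) (g : Q) :
    cocycleMonodromy hc (p.trans q) g = cocycleMonodromy hc q (cocycleMonodromy hc p g) := by
  have eta : ∀ e : (cocycleBundle hc).proj ⁻¹' {b}, e = ⟨⟨b, e.1.2⟩, rfl⟩ := by
    rintro ⟨⟨_, _⟩, rfl⟩
    rfl
  rw [cocycleMonodromy, IsCoveringMap.monodromy_trans_apply, eta (IsCoveringMap.monodromy _ p _)]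
  rfl

theorem cocycleMonodromy_mk_of_openStar (hc : IsEdgeCocycle K c) {a b : Realization K}
    {f : Path a b} {v : ι} (hf : ∀ t, f t ∈ openStar K v) (g : Q) :
    cocycleMonodromy hc ⟪f⟫ g = c v (someVertex b) * (c (someVertex a) v * g) := by
  let Z := cocycleBundle hc
  let lift : I → Z.TotalSpace := fun t => ⟨f t, c v (someVertex (f t)) * (c (someVertex a) v * g)⟩
  have hlift : Continuous lift :=
    (Z.localTriv v).toOpenPartialHomeomorph.continuousOn_symm.comp_continuous
      (f := fun t => (f t, c (someVertex a) v * g)) (by fun_prop)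
      fun t => (Z.mem_localTriv_target v _).2 (hf t)
  have ha : v ∈ a.weight.support := by simpa [openStar] using hf 0
  have round_trip : c v (someVertex a) * c (someVertex a) v = 1 :=
    (hc _ a.support_mem _ (someVertex_mem a) _ ha _ (someVertex_mem a)).trans (hc.self _)
  have lift_zero : lift 0 = ⟨a, g⟩ := by
    have : ∀ x, x = a →
        (⟨x, c v (someVertex x) * (c (someVertex a) v * g)⟩ : Z.TotalSpace) = ⟨a, g⟩ := by
      rintro _ rfl
      rw [← mul_assoc, round_trip, one_mul]
    exact this _ f.source
  have eq_lift := ((isCoveringMap_cocycleBundle hc).eq_liftPath_iff (γ := f.toContinuousMap)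
    (e := ⟨a, g⟩) f.source).2 ⟨hlift, rfl, lift_zero⟩
  calc cocycleMonodromy hc ⟪f⟫ g
      = c v (someVertex (f 1)) * (c (someVertex a) v * g) :=
        congrArg (fun e : Z.TotalSpace => (e.2 : Q)) (congrFun eq_lift 1).symm
    _ = c v (someVertex b) * (c (someVertex a) v * g) := by rw [f.target]

theorem cocycleMonodromy_mul_right (hc : IsEdgeCocycle K c) {a b : Realization K}
    (p : Path.Homotopic.Quotient a b) (g g' : Q) :
    cocycleMonodromy hc p (g * g') = cocycleMonodromy hc p g * g' := by
  induction p with | mk f => ?_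
  refine pathClass_of_eventually_subpath (P := fun p => ∀ g : Q,
    cocycleMonodromy hc p (g * g') = cocycleMonodromy hc p g * g')
    (fun hp hq g => by rw [cocycleMonodromy_trans, hp, hq, cocycleMonodromy_trans]) f
    (fun t => ?_) g
  filter_upwards [eventually_subpath_mem f ((isOpen_openStar (someVertex (f t))).mem_nhds
    (someVertex_mem (f t)))] with ab hab g
  simp only [cocycleMonodromy_mk_of_openStar hc hab, mul_assoc]

end Monodromy

/-- The transport along paths of the realization defined by an edge cocycle: the monodromy of the
covering glued by the cocycle. -/
def cocycleTransport {c : ι → ι → Q} (hc : IsEdgeCocycle K c) :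
    PathTransport (Realization K) Q :=
  letI : TopologicalSpace Q := ⊥
  haveI : DiscreteTopology Q := ⟨rfl⟩
  { map := fun p => cocycleMonodromy hc p 1
    map_trans := fun p q => by
      rw [cocycleMonodromy_trans, ← cocycleMonodromy_mul_right, one_mul] }

variable {c : ι → ι → Q}

theorem cocycleTransport_mk_of_openStar (hc : IsEdgeCocycle K c) {a b : Realization K}
    {f : Path a b} {v : ι} (hf : ∀ t, f t ∈ openStar K v) :
    (cocycleTransport hc).map ⟪f⟫ = c v (someVertex b) * c (someVertex a) v := by
  let _ : TopologicalSpace Q := ⊥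
  have : DiscreteTopology Q := ⟨rfl⟩
  exact (cocycleMonodromy_mk_of_openStar hc hf 1).trans (by rw [mul_one])

theorem cocycleTransport_seg_of_openStar (hc : IsEdgeCocycle K c) {a b : Realization K} {v : ι}
    (hab : Contiguous a b) (ha : a ∈ openStar K v) (hb : b ∈ openStar K v) :
    (cocycleTransport hc).map (seg hab) = c (someVertex a) (someVertex b) := by
  rw [seg, cocycleTransport_mk_of_openStar hc (segPath_mem_openStar hab ha hb)]
  obtain ⟨τ, hτ, haτ, hbτ⟩ := hab
  exact hc τ hτ _ (haτ (someVertex_mem a)) _ (haτ ha) _ (hbτ (someVertex_mem b))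

theorem cocycleTransport_seg (hc : IsEdgeCocycle K c) {a b : Realization K}
    (hab : Contiguous a b) :
    (cocycleTransport hc).map (seg hab) = c (someVertex a) (someVertex b) := by
  obtain ⟨t, ht_pos, ht_lt⟩ := exists_between (zero_lt_one' I)
  have ham := contiguous_segPath_left hab t
  have hmb := (contiguous_segPath_right hab t).symm
  have left := cocycleTransport_seg_of_openStar hc ham (someVertex_mem a)
    (segPath_mem_openStar_left hab (someVertex_mem a) ht_lt)
  have right := cocycleTransport_seg_of_openStar hc hmb
    (segPath_mem_openStar_right hab (someVertex_mem b) ht_pos) (someVertex_mem b)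
  obtain ⟨τ, hτ, haτ, hbτ⟩ := id hab
  have hmτ := support_segPath_subset hab haτ hbτ t
  rw [← seg_trans_seg hτ haτ hmτ hbτ ham hmb hab, PathTransport.map_trans, left, right]
  exact hc τ hτ _ (haτ (someVertex_mem a)) _ (hmτ (someVertex_mem _)) _ (hbτ (someVertex_mem b))

end Covering

section Geodesic

variable {X : Type*} [MetricSpace X]

theorem IsGeodesicSpace.exists_path (hX : IsGeodesicSpace X) (x y : X) :
    ∃ γ : Path x y, ∀ s t, dist (γ s) (γ t) = dist x y * dist s t := by
  obtain ⟨f, hf_zero, hf_one, hf⟩ := hX x y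
  have mem (t : I) : dist x y * t ∈ Set.Icc 0 (dist x y) :=
    ⟨mul_nonneg dist_nonneg t.2.1, mul_le_of_le_one_right dist_nonneg t.2.2⟩
  have hdist (s t : I) : dist (f (dist x y * s)) (f (dist x y * t)) = dist x y * dist s t := by
    rw [hf _ (mem s) _ (mem t), ← mul_sub, abs_mul, abs_of_nonneg dist_nonneg]
    rfl
  have hlip : LipschitzWith (nndist x y) fun t : I => f (dist x y * t) :=
    LipschitzWith.of_dist_le_mul fun s t => (hdist s t).le
  exact ⟨⟨⟨_, hlip.continuous⟩, by simpa using hf_zero, by simpa using hf_one⟩, hdist⟩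

/-- A choice of a geodesic, parametrized by `[0, 1]`, between two points. -/
def IsGeodesicSpace.geodesicPath (hX : IsGeodesicSpace X) (x y : X) : Path x y :=
  (hX.exists_path x y).choose

theorem IsGeodesicSpace.dist_geodesicPath (hX : IsGeodesicSpace X) (x y : X) (s t : I) :
    dist (hX.geodesicPath x y s) (hX.geodesicPath x y t) = dist x y * dist s t :=
  (hX.exists_path x y).choose_spec s t

theorem IsGeodesicSpace.dist_left_geodesicPath (hX : IsGeodesicSpace X) (x y : X) (t : I) :
    dist x (hX.geodesicPath x y t) = dist x y * t := by
  have h := hX.dist_geodesicPath x y 0 t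
  rwa [Path.source, Subtype.dist_eq, Set.Icc.coe_zero, dist_zero_left, Real.norm_of_nonneg t.2.1]
    at h

theorem IsGeodesicSpace.dist_left_geodesicPath_le (hX : IsGeodesicSpace X) (x y : X) (t : I) :
    dist x (hX.geodesicPath x y t) ≤ dist x y :=
  (hX.dist_left_geodesicPath x y t).trans_le (mul_le_of_le_one_right dist_nonneg t.2.2)

theorem IsGeodesicSpace.dist_geodesicPath_right (hX : IsGeodesicSpace X) (x y : X) (t : I) :
    dist (hX.geodesicPath x y t) y = dist x y * (1 - t) := by
  have h := hX.dist_geodesicPath x y t 1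
  rwa [Path.target, dist_comm t, Subtype.dist_eq, Set.Icc.coe_one, Real.dist_eq,
    abs_of_nonneg (unitInterval.one_minus_nonneg t)] at h

end Geodesic

section Rips

open Realization

variable {X : Type*} [MetricSpace X] {r : ℝ} {hr : 0 < r}

theorem mem_rips_faces {σ : Finset X} (hσ : σ.Nonempty) (h : ∀ x ∈ σ, ∀ y ∈ σ, dist x y < r) :
    σ ∈ (rips X r hr).faces := by
  refine ⟨hσ, ?_⟩
  obtain ⟨p, hp, hmax⟩ := (σ ×ˢ σ).exists_max_image (fun p => dist p.1 p.2) (hσ.product hσ)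
  rw [Finset.mem_product] at hp
  refine lt_of_le_of_lt (Metric.diam_le_of_forall_dist_le dist_nonneg fun x hx y hy => ?_)
    (h _ hp.1 _ hp.2)
  exact hmax (x, y) (Finset.mem_product.2 ⟨hx, hy⟩)

theorem dist_lt_of_mem_rips_faces {σ : Finset X} (h : σ ∈ (rips X r hr).faces) {x y : X}
    (hx : x ∈ σ) (hy : y ∈ σ) : dist x y < r :=
  (Metric.dist_le_diam_of_mem σ.finite_toSet.isBounded hx hy).trans_lt h.2

theorem mem_rips_faces_of_dist_lt_half {σ : Finset X} (hσ : σ.Nonempty) (x : X)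
    (h : ∀ y ∈ σ, dist x y < r / 2) : σ ∈ (rips X r hr).faces :=
  mem_rips_faces hσ fun y hy z hz => by
    linarith [dist_triangle_left y z x, h y hy, h z hz]

theorem contiguous_vertex_vertex {x y : X} (h : dist x y < r) :
    Contiguous (vertex (rips X r hr) x) (vertex (rips X r hr) y) := by
  classical
  refine ⟨{x, y}, mem_rips_faces (by simp) ?_, by simp, by simp⟩
  simp [dist_comm y x, h, hr]

/-- The class of the edge between two vertices of the Rips complex at distance less than `r`. -/
def edge (hr : 0 < r) {x y : X} (h : dist x y < r) :
    Path.Homotopic.Quotient (vertex (rips X r hr) x) (vertex (rips X r hr) y) :=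
  seg (contiguous_vertex_vertex h)

theorem edge_self {x : X} (h : dist x x < r) : edge hr h = Path.Homotopic.Quotient.refl _ :=
  seg_self _

theorem edge_trans {x y z : X} (hxy : dist x y < r) (hyz : dist y z < r) (hxz : dist x z < r) :
    (edge hr hxy).trans (edge hr hyz) = edge hr hxz := by
  classical
  refine seg_trans_seg (τ := {x, y, z}) (mem_rips_faces (by simp) ?_) (by simp) (by simp)
    (by simp) _ _ _
  simp [dist_comm y x, dist_comm z x, dist_comm z y, hxy, hyz, hxz, hr]

theorem seg_trans_mk_trans_seg_of_openStar {a b : Realization (rips X r hr)} {f : Path a b}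
    {u v w : X} (hf : ∀ t, f t ∈ openStar _ w) (hu : a ∈ openStar _ u) (hv : b ∈ openStar _ v)
    (huw : dist u w < r) (hwv : dist w v < r) :
    (seg (contiguous_vertex hu).symm).trans (⟪f⟫.trans (seg (contiguous_vertex hv))) =
      (edge hr huw).trans (edge hr hwv) := by
  have ha : a ∈ openStar _ w := by simpa using hf 0
  have hb : b ∈ openStar _ w := by simpa using hf 1
  have vertex_subset : ∀ {c : Realization (rips X r hr)} {z : X}, c ∈ openStar _ z →
      (vertex (rips X r hr) z).weight.support ⊆ c.weight.support := fun {_ _} h => by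
    rwa [support_vertex, Finset.singleton_subset_iff]
  rw [mk_eq_seg_trans_seg_of_openStar hf (contiguous_vertex ha) (contiguous_vertex hb).symm,
    Path.Homotopic.Quotient.trans_assoc, ← Path.Homotopic.Quotient.trans_assoc (seg _) (seg _) _]
  congr 1
  · exact seg_trans_seg a.support_mem (vertex_subset hu) subset_rfl (vertex_subset ha) _ _ _
  · exact seg_trans_seg b.support_mem (vertex_subset hb) subset_rfl (vertex_subset hv) _ _ _

/-- A continuous map from a metric space to its Rips complex that moves each point only slightly:
a coarse inverse to the nonexistent inclusion of the Rips complex in `X`. -/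
structure FineMap (X : Type*) [MetricSpace X] (r : ℝ) (hr : 0 < r) where
  map : C(X, Realization (rips X r hr))
  near : ∀ x, ∀ v ∈ (map x).weight.support, dist x v < r / 10

/-- The barycentric coordinates given by a partition of unity with small supports. -/
theorem nonempty_fineMap (X : Type*) [MetricSpace X] (r : ℝ) (hr : 0 < r) :
    Nonempty (FineMap X r hr) := by
  obtain ⟨ρ, hρ⟩ := PartitionOfUnity.exists_isSubordinate isClosed_univ
    (fun v : X => Metric.ball v (r / 10)) (fun _ => Metric.isOpen_ball)
    fun x _ => Set.mem_iUnion.2 ⟨x, Metric.mem_ball_self (by positivity)⟩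
  let w (x : X) : X →₀ ℝ := Finsupp.onFinset (ρ.finsupport x) (fun v => ρ v x) fun _ =>
    (ρ.mem_finsupport x).2
  have dist_lt {x v : X} (hv : v ∈ (w x).support) : dist x v < r / 10 :=
    hρ v (subset_tsupport _ (Finsupp.mem_support_iff.1 hv))
  have sum_eq (x : X) : ((w x).sum fun _ a => a) = 1 :=
    (Finsupp.onFinset_sum _ fun _ => rfl).trans (ρ.sum_finsupport (Set.mem_univ x))
  let f (x : X) : Realization (rips X r hr) :=
    { weight := w x
      nonneg := fun v => ρ.nonneg v x
      sum_eq_one := sum_eq x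
      support_mem := mem_rips_faces_of_dist_lt_half (support_nonempty_of_sum_eq_one (sum_eq x)) x
        fun v hv => by linarith [dist_lt hv] }
  have hf : Continuous f := continuous_of_locallyFinite
    (ρ.locallyFinite.subset fun v x hv => Finsupp.mem_support_iff.1 hv) fun v => (ρ v).continuous
  exact ⟨⟨⟨f, hf⟩, fun _ _ => dist_lt⟩⟩

namespace FineMap

variable (Φ : FineMap X r hr)

theorem contiguous {x y : X} (h : dist x y < r / 5) :
    Contiguous (vertex (rips X r hr) x) (Φ.map y) := by
  classical
  refine ⟨insert x (Φ.map y).weight.support,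
    mem_rips_faces_of_dist_lt_half (by simp) x fun v hv => ?_, by simp, Finset.subset_insert _ _⟩
  rcases Finset.mem_insert.1 hv with rfl | hv
  · simpa using half_pos hr
  · linarith [Φ.near y v hv, dist_triangle x y v]

theorem contiguous_self (x : X) : Contiguous (vertex (rips X r hr) x) (Φ.map x) :=
  Φ.contiguous (by simpa using hr)

/-- The path class in the Rips complex, between vertices, induced by a path class of `X`. -/
def mapClass {x y : X} (p : Path.Homotopic.Quotient x y) :
    Path.Homotopic.Quotient (vertex (rips X r hr) x) (vertex (rips X r hr) y) :=
  (seg (Φ.contiguous_self x)).trans ((p.map Φ.map).trans (seg (Φ.contiguous_self y)).symm)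

theorem mapClass_refl (x : X) :
    Φ.mapClass (Path.Homotopic.Quotient.refl x) = Path.Homotopic.Quotient.refl _ := by
  have map_refl : (Path.Homotopic.Quotient.refl x).map Φ.map = .refl (Φ.map x) := rfl
  rw [mapClass, map_refl, Path.Homotopic.Quotient.refl_trans, Path.Homotopic.Quotient.trans_symm]

theorem mapClass_trans {x y z : X} (p : Path.Homotopic.Quotient x y)
    (q : Path.Homotopic.Quotient y z) :
    Φ.mapClass (p.trans q) = (Φ.mapClass p).trans (Φ.mapClass q) := by
  simp only [mapClass, pathClass_map_trans, Path.Homotopic.Quotient.trans_assoc,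
    pathClass_symm_trans_cancel]

/-- The homomorphism that a fine map induces on fundamental groups. -/
def hom (x₀ : X) : FundamentalGroup X x₀ →* RipsPi1 x₀ r hr where
  toFun g := FundamentalGroup.fromPath (Φ.mapClass (FundamentalGroup.toPath g))
  map_one' := Φ.mapClass_refl x₀
  map_mul' _ _ := Φ.mapClass_trans _ _

/-- The transport on `X` obtained from one on its Rips complex. -/
def pullback {Q : Type*} [Group Q] (T : PathTransport (Realization (rips X r hr)) Q) :
    PathTransport X Q where
  map p := T.map (Φ.mapClass p)
  map_trans p q := by rw [Φ.mapClass_trans, T.map_trans]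

theorem pullback_map {Q : Type*} [Group Q] (T : PathTransport (Realization (rips X r hr)) Q)
    {x y : X} (p : Path.Homotopic.Quotient x y) : (Φ.pullback T).map p = T.map (Φ.mapClass p) :=
  rfl

theorem mapClass_mk_of_dist_lt {x y : X} {γ : Path x y} (h : ∀ t, dist (γ t) x < r / 5)
    (hd : dist x y < r) : Φ.mapClass ⟪γ⟫ = edge hr hd := by
  classical
  have hy : dist x y < r / 5 := by simpa [dist_comm] using h 1
  have mk_map := mk_eq_seg_trans_of_contiguous (f := γ.map Φ.map.continuous)
    (g := Path.refl (vertex (rips X r hr) x))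
    (fun t => (Φ.contiguous (by simpa [dist_comm] using h t)).symm)
    (Φ.contiguous_self x).symm (Φ.contiguous hy)
  have hτ : insert x (insert y (Φ.map y).weight.support) ∈ (rips X r hr).faces := by
    refine mem_rips_faces_of_dist_lt_half (by simp) y fun v hv => ?_
    rcases Finset.mem_insert.1 hv with rfl | hv
    · linarith [dist_comm y v]
    rcases Finset.mem_insert.1 hv with rfl | hv
    · simpa using half_pos hr
    · linarith [Φ.near y v hv]
  rw [mapClass, ← Path.Homotopic.Quotient.mk_map, mk_map, ← seg_symm (Φ.contiguous_self x),
    Path.Homotopic.Quotient.trans_assoc, pathClass_trans_symm_cancel,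
    Path.Homotopic.Quotient.mk_refl, Path.Homotopic.Quotient.refl_trans, seg_symm]
  exact seg_trans_seg hτ (by simp) ((Finset.subset_insert _ _).trans (Finset.subset_insert _ _))
    (by simp) _ _ _

theorem eventually_mapClass_subpath_eq_edge {x y : X} (γ : Path x y) (t : I) {η : ℝ}
    (hη : 0 < η) : ∀ᶠ ab in 𝓝 (t, t), dist (γ ab.1) (γ ab.2) < η ∧
      ∃ hd : dist (γ ab.1) (γ ab.2) < r, Φ.mapClass ⟪γ.subpath ab.1 ab.2⟫ = edge hr hd := by
  filter_upwards [eventually_dist_subpath_lt γ t (lt_min hη (by positivity : 0 < r / 5))] with ab h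
  have hab : dist (γ ab.1) (γ ab.2) < min η (r / 5) := by
    simpa only [dist_comm, Path.target] using h 1
  exact ⟨hab.trans_le (min_le_left _ _), by linarith [hab.trans_le (min_le_right _ _)],
    Φ.mapClass_mk_of_dist_lt (fun s => (h s).trans_le (min_le_right _ _)) _⟩

theorem trans_mapClass_of_compatible {c : Realization (rips X r hr)} {S : Set X}
    (e : ∀ y ∈ S, Path.Homotopic.Quotient c (vertex (rips X r hr) y)) {η : ℝ} (hη : 0 < η)
    (he : ∀ y y' (hy : y ∈ S) (hy' : y' ∈ S) (hd : dist y y' < r), dist y y' < η →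
      (e y hy).trans (edge hr hd) = e y' hy')
    {x y : X} (γ : Path x y) (hγ : ∀ t, γ t ∈ S) (hx : x ∈ S) (hy : y ∈ S) :
    (e x hx).trans (Φ.mapClass ⟪γ⟫) = e y hy := by
  have compatible := pathClass_of_eventually_subpath (P := fun {x y} p => ∃ (hx : x ∈ S)
    (hy : y ∈ S), (e x hx).trans (Φ.mapClass p) = e y hy) (fun ⟨hx, hy, hp⟩ ⟨_, hz, hq⟩ =>
      ⟨hx, hz, by rw [Φ.mapClass_trans, ← Path.Homotopic.Quotient.trans_assoc, hp, hq]⟩) γ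
    fun t => by
      filter_upwards [Φ.eventually_mapClass_subpath_eq_edge γ t hη] with ab ⟨hlt, hd, hedge⟩
      exact ⟨hγ _, hγ _, hedge ▸ he _ _ _ _ hd hlt⟩
  exact compatible.2.2

theorem mapClass_mk_of_forall_dist_left_lt {x y : X} (γ : Path x y) (h : ∀ t, dist x (γ t) < r)
    (hd : dist x y < r) : Φ.mapClass ⟪γ⟫ = edge hr hd := by
  have hx : dist x x < r := by simpa using hr
  have compatible := Φ.trans_mapClass_of_compatible (S := {y | dist x y < r})
    (fun y hy => edge hr hy) hr (fun y y' hy hy' hd _ => edge_trans hy hd hy') γ h hx hd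
  rwa [edge_self, Path.Homotopic.Quotient.refl_trans] at compatible

/-- The disc filling the loop is the cone over it with apex the centre of the ball, whose edges
are subdivided by points at two thirds of the radius. -/
theorem mapClass_mk_of_closedBall (hX : IsGeodesicSpace X) {y w : X} {d : ℝ} (hd : d < 3 * r / 2)
    (β : Path y y) (hβ : Set.range β ⊆ Metric.closedBall w d) :
    Φ.mapClass ⟪β⟫ = Path.Homotopic.Quotient.refl _ := by
  let m (z : X) : X := hX.geodesicPath w z ⟨2 / 3, by norm_num, by norm_num⟩
  have hwm (z : X) (hz : dist z w ≤ d) : dist w (m z) ≤ 2 * d / 3 := by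
    simp only [m, hX.dist_left_geodesicPath]
    linarith [dist_comm z w]
  have hmz (z : X) (hz : dist z w ≤ d) : dist (m z) z ≤ d / 3 := by
    simp only [m, hX.dist_geodesicPath_right]
    linarith [dist_comm z w]
  have hy : y ∈ Metric.closedBall w d := hβ ⟨0, β.source⟩
  have hwm' (z : X) (hz : dist z w ≤ d) : dist w (m z) < r := by linarith [hwm z hz]
  have hmz' (z : X) (hz : dist z w ≤ d) : dist (m z) z < r := by linarith [hmz z hz]
  have compatible := Φ.trans_mapClass_of_compatible (S := Metric.closedBall w d)
    (fun z hz => (edge hr (hwm' z hz)).trans (edge hr (hmz' z hz)))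
    (η := (r - 2 * d / 3) / 2) (by linarith) (fun z z' hz hz' hzz hη => by
      have hmz_z' : dist (m z) z' < r := by
        linarith [dist_triangle (m z) z z', hmz z hz]
      have hmz_mz' : dist (m z) (m z') < r := by
        linarith [dist_triangle_right (m z) (m z') z', dist_triangle (m z) z z', hmz z hz,
          hmz z' hz']
      rw [Path.Homotopic.Quotient.trans_assoc, edge_trans _ _ hmz_z',
        ← edge_trans (hwm' z hz) hmz_mz' (hwm' z' hz'), Path.Homotopic.Quotient.trans_assoc,
        edge_trans hmz_mz' _ hmz_z'])
    β (fun t => hβ ⟨t, rfl⟩) hy hy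
  rw [← pathClass_symm_trans_cancel ((edge hr (hwm' y hy)).trans (edge hr (hmz' y hy)))
    (Φ.mapClass ⟪β⟫), compatible, Path.Homotopic.Quotient.symm_trans]

theorem mapClass_geodesicPath (hX : IsGeodesicSpace X) {x y : X} (hd : dist x y < r) :
    Φ.mapClass ⟪hX.geodesicPath x y⟫ = edge hr hd :=
  Φ.mapClass_mk_of_forall_dist_left_lt _
    (fun t => (hX.dist_left_geodesicPath_le x y t).trans_lt hd) hd

theorem mapClass_surjective (hX : IsGeodesicSpace X) (u v : X) :
    Function.Surjective (Φ.mapClass : Path.Homotopic.Quotient u v → _) := by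
  intro q
  induction q with | mk f => ?_
  have lift := pathClass_of_eventually_subpath (P := fun {a b} q =>
    ∀ u (hu : a ∈ openStar _ u) v (hv : b ∈ openStar _ v), ∃ p : Path.Homotopic.Quotient u v,
      Φ.mapClass p = (seg (contiguous_vertex hu).symm).trans
        (q.trans (seg (contiguous_vertex hv)))) ?_ f fun t => ?_
  · obtain ⟨p, hp⟩ := lift u (vertex_mem_openStar u) v (vertex_mem_openStar v)
    exact ⟨p, by rw [hp, seg_self, seg_self, Path.Homotopic.Quotient.refl_trans,
      Path.Homotopic.Quotient.trans_refl]⟩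
  · intro a b d p q hp hq u hu v hv
    have hw : b ∈ openStar _ (someVertex b) := someVertex_mem b
    obtain ⟨p', hp'⟩ := hp u hu _ hw
    obtain ⟨q', hq'⟩ := hq _ hw v hv
    refine ⟨p'.trans q', ?_⟩
    simp only [mapClass_trans, hp', hq', Path.Homotopic.Quotient.trans_assoc,
      ← seg_symm (contiguous_vertex hw), pathClass_trans_symm_cancel]
  · filter_upwards [eventually_subpath_mem f ((isOpen_openStar (someVertex (f t))).mem_nhds
      (someVertex_mem (f t)))] with ab hab u hu v hv
    set w := someVertex (f t)
    have hwa : f ab.1 ∈ openStar _ w := by simpa using hab 0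
    have hwb : f ab.2 ∈ openStar _ w := by simpa using hab 1
    have huw : dist u w < r := dist_lt_of_mem_rips_faces (f ab.1).support_mem hu hwa
    have hwv : dist w v < r := dist_lt_of_mem_rips_faces (f ab.2).support_mem hwb hv
    refine ⟨⟪hX.geodesicPath u w⟫.trans ⟪hX.geodesicPath w v⟫, ?_⟩
    rw [mapClass_trans, mapClass_geodesicPath _ hX huw, mapClass_geodesicPath _ hX hwv,
      seg_trans_mk_trans_seg_of_openStar hab hu hv huw hwv]

/-- A fine map followed by the inclusion of the Rips complex in that of a larger scale. -/
def inclusion {s : ℝ} (h : r ≤ s) : FineMap X s (hr.trans_le h) where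
  map := (Realization.inclusion (rips_mono hr h)).comp Φ.map
  near x v hv := (Φ.near x v hv).trans_le (by linarith)

theorem mapClass_inclusion {s : ℝ} (h : r ≤ s) {x y : X} (p : Path.Homotopic.Quotient x y) :
    (Φ.inclusion h).mapClass p = (Φ.mapClass p).map (Realization.inclusion (rips_mono hr h)) := by
  rw [mapClass, mapClass, seg_symm, seg_symm, pathClass_map_trans, pathClass_map_trans,
    ← Path.Homotopic.Quotient.map_comp]
  rfl

theorem hom_inclusion (x₀ : X) {s : ℝ} (h : r ≤ s) :
    (Φ.inclusion h).hom x₀ = (bonding x₀ hr h).comp (Φ.hom x₀) :=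
  MonoidHom.ext fun _ => Φ.mapClass_inclusion h _

end FineMap

end Rips

section Length

variable {X : Type*} [MetricSpace X] {K : ℝ≥0} {x y z : X}

theorem univ_inter_Icc_zero_one : Set.univ ∩ Set.Icc (0 : I) 1 = Set.univ := by
  rw [Set.univ_inter, ← Set.Icc_bot_top]
  rfl

theorem IsGeodesicSpace.lipschitzWith_geodesicPath (hX : IsGeodesicSpace X) (x y : X) :
    LipschitzWith (nndist x y) (hX.geodesicPath x y) :=
  LipschitzWith.of_dist_le_mul fun s t => (hX.dist_geodesicPath x y s t).le

theorem lipschitzWith_subpath {γ : Path x y} (hγ : LipschitzWith K γ) (a b : I) :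
    LipschitzWith (K * nndist a b) (γ.subpath a b) := by
  refine LipschitzWith.of_dist_le_mul fun s t => (hγ.dist_le_mul _ _).trans (le_of_eq ?_)
  have hcoe (u : I) : (Set.Icc.convexComb a b u : ℝ) = (1 - u) * a + u * b := by
    simp [Set.Icc.convexComb]
  rw [NNReal.coe_mul, coe_nndist, mul_assoc]
  congr 1
  simp only [Subtype.dist_eq, Real.dist_eq, hcoe]
  rw [← abs_mul, abs_sub_comm]
  congr 1
  ring

theorem pathLength_le_of_lipschitzWith {γ : Path x y} (hγ : LipschitzWith K γ) :
    pathLength γ ≤ K := by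
  have hcoe : eVariationOn (id : I → I) Set.univ ≤ 1 := by
    have hmono : MonotoneOn (Subtype.val : I → ℝ) Set.univ := fun _ _ _ _ h => h
    have hle := (hmono.eVariationOn_eq (Set.mem_univ 0) (Set.mem_univ 1)).le
    rw [univ_inter_Icc_zero_one] at hle
    exact hle.trans (by simp)
  calc pathLength γ ≤ K * eVariationOn (id : I → I) Set.univ :=
        hγ.lipschitzOnWith.comp_eVariationOn_le (Set.mapsTo_univ id Set.univ)
    _ ≤ K := mul_le_of_le_one_right' hcoe

theorem pathLength_symm (γ : Path x y) : pathLength γ.symm = pathLength γ := by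
  have hle : ∀ {x y : X} (γ : Path x y), pathLength γ.symm ≤ pathLength γ := fun γ =>
    eVariationOn.comp_le_of_antitoneOn γ unitInterval.symm
      (fun _ _ _ _ h => unitInterval.symm_le_symm.2 h) (Set.mapsTo_univ _ _)
  exact (hle γ).antisymm (by simpa only [Path.symm_symm] using hle γ.symm)

theorem pathLength_trans_le (γ : Path x y) (δ : Path y z) :
    pathLength (γ.trans δ) ≤ pathLength γ + pathLength δ := by
  let half : I := ⟨1 / 2, by norm_num, by norm_num⟩
  have hmono (a : ℝ) : Monotone fun t : I => Set.projIcc (0 : ℝ) 1 zero_le_one (2 * t - a) :=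
    fun s t (hst : (s : ℝ) ≤ t) => Set.monotone_projIcc _ (by linarith)
  have hleft : Set.EqOn (γ.trans δ) (γ ∘ fun t : I => Set.projIcc 0 1 zero_le_one (2 * t - 0))
      (Set.univ ∩ Set.Icc 0 half) := fun t ht => by
    rw [← Path.extend_apply (γ.trans δ) t.2, Path.extend_trans_of_le_half γ δ ht.2.2,
      Function.comp_apply, sub_zero]
    rfl
  have hright : Set.EqOn (γ.trans δ) (δ ∘ fun t : I => Set.projIcc 0 1 zero_le_one (2 * t - 1))
      (Set.univ ∩ Set.Icc half 1) := fun t ht => by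
    rw [← Path.extend_apply (γ.trans δ) t.2, Path.extend_trans_of_half_le γ δ ht.2.1]
    rfl
  have hsplit := eVariationOn.Icc_add_Icc (γ.trans δ) (unitInterval.nonneg' (t := half))
    unitInterval.le_one' (Set.mem_univ half)
  rw [univ_inter_Icc_zero_one] at hsplit
  rw [pathLength, ← hsplit, eVariationOn.congr hleft, eVariationOn.congr hright]
  exact add_le_add
    (eVariationOn.comp_le_of_monotoneOn γ _ ((hmono 0).monotoneOn _) (Set.mapsTo_univ _ _))
    (eVariationOn.comp_le_of_monotoneOn δ _ ((hmono 1).monotoneOn _) (Set.mapsTo_univ _ _))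

theorem exists_continuous_arcLength {β : Path x y} (hβ : pathLength β ≠ ⊤) :
    ∃ V : I → ℝ, Continuous V ∧ V 0 = 0 ∧ V 1 = (pathLength β).toReal ∧
      ∀ s t, s ≤ t → dist (β s) (β t) ≤ V t - V s := by
  let W (s t : I) : ENNReal := eVariationOn β (Set.univ ∩ Set.Icc s t)
  have hW (s t) : W s t ≠ ⊤ := ne_top_of_le_ne_top hβ (eVariationOn.mono β (Set.subset_univ _))
  have hsub (s t) (hst : s ≤ t) : (W 0 t).toReal - (W 0 s).toReal = (W s t).toReal := by
    rw [sub_eq_iff_eq_add', ← ENNReal.toReal_add (hW _ _) (hW _ _)]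
    exact congrArg ENNReal.toReal
      (eVariationOn.Icc_add_Icc β unitInterval.nonneg' hst (Set.mem_univ s)).symm
  refine ⟨fun t => (W 0 t).toReal, continuous_iff_continuousAt.2 fun t => ?_, ?_, ?_,
    fun s t hst => ?_⟩
  · refine Metric.tendsto_nhds.2 fun ε hε => ?_
    have hleft := BoundedVariationOn.tendsto_eVariationOn_Icc_zero_left hβ (x := t)
      β.continuous.continuousAt.continuousWithinAt
    have hright := BoundedVariationOn.tendsto_eVariationOn_Icc_zero_right hβ t
      β.continuous.continuousAt.continuousWithinAt
    rw [nhdsWithin_univ] at hleft hright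
    have hε' : (0 : ENNReal) < ENNReal.ofReal ε := ENNReal.ofReal_pos.2 hε
    filter_upwards [hleft.eventually_lt_const hε', hright.eventually_lt_const hε'] with s hst hts
    rcases le_total s t with h | h
    · rw [dist_comm, Real.dist_eq, hsub s t h, abs_of_nonneg ENNReal.toReal_nonneg]
      exact (ENNReal.lt_ofReal_iff_toReal_lt (hW s t)).1 hst
    · rw [Real.dist_eq, hsub t s h, abs_of_nonneg ENNReal.toReal_nonneg]
      exact (ENNReal.lt_ofReal_iff_toReal_lt (hW t s)).1 hts
  · exact congrArg ENNReal.toReal (eVariationOn.subsingleton β (by simp))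
  · exact congrArg (fun s => (eVariationOn β s).toReal) univ_inter_Icc_zero_one
  · rw [hsub s t hst, dist_edist]
    exact ENNReal.toReal_mono (hW _ _) (eVariationOn.edist_le β
      ⟨Set.mem_univ _, le_rfl, hst⟩ ⟨Set.mem_univ _, hst, le_rfl⟩)

theorem exists_lipschitzWith_of_dist_le {β : Path x y} {φ : I → I} (hφ : Continuous φ)
    (hφ_zero : φ 0 = 0) (hφ_one : φ 1 = 1)
    (hdist : ∀ s t, dist (β s) (β t) ≤ K * dist (φ s) (φ t)) :
    ∃ γ : Path x y, LipschitzWith K γ ∧ ⟪γ⟫ = ⟪β⟫ := by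
  have hsurj : Function.Surjective φ := fun u => by
    have hivt := intermediate_value_univ (0 : I) 1 hφ
    rw [hφ_zero, hφ_one] at hivt
    exact hivt ⟨unitInterval.nonneg', unitInterval.le_one'⟩
  have heq (s t) (h : φ s = φ t) : β s = β t := dist_le_zero.1 (by simpa [h] using hdist s t)
  choose ψ hψ using hsurj
  have hlip : LipschitzWith K fun t => β (ψ t) := LipschitzWith.of_dist_le_mul fun s t => by
    simpa only [hψ] using hdist (ψ s) (ψ t)
  let γ : Path x y :=
    { toFun := fun t => β (ψ t)
      continuous_toFun := hlip.continuous
      source' := (heq _ _ ((hψ 0).trans hφ_zero.symm)).trans β.source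
      target' := (heq _ _ ((hψ 1).trans hφ_one.symm)).trans β.target }
  have hreparam : γ.reparam φ hφ hφ_zero hφ_one = β := by
    ext t
    exact heq _ _ (hψ _)
  refine ⟨γ, hlip, ?_⟩
  conv_rhs => rw [← hreparam]
  exact Path.Homotopic.Quotient.eq.2 ⟨Path.Homotopy.reparam γ φ hφ hφ_zero hφ_one⟩

theorem exists_lipschitzWith_of_pathLength_lt {β : Path x y} {l : ℝ}
    (h : pathLength β < ENNReal.ofReal l) :
    ∃ K : ℝ≥0, (K : ℝ) < l ∧ ∃ γ : Path x y, LipschitzWith K γ ∧ ⟪γ⟫ = ⟪β⟫ := by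
  have hfin : pathLength β ≠ ⊤ := ne_top_of_lt h
  obtain ⟨V, hV_cont, hV_zero, hV_one, hV⟩ := exists_continuous_arcLength hfin
  have hV_mono : Monotone V := fun s t hst => sub_nonneg.1 (dist_nonneg.trans (hV s t hst))
  have hV_nonneg (t) : 0 ≤ V t := hV_zero ▸ hV_mono unitInterval.nonneg'
  have hV_one_lt : V 1 < l := hV_one ▸ (ENNReal.lt_ofReal_iff_toReal_lt hfin).1 h
  -- The slack `δ = m - V 1` keeps the divisor `m` positive when `β` is constant.
  obtain ⟨m, hVm, hml⟩ := exists_between hV_one_lt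
  let δ := m - V 1
  have hδ : 0 < δ := sub_pos.2 hVm
  have hm : 0 < m := (hV_nonneg 1).trans_lt hVm
  have hbound (t : I) : (V t + δ * t) / m ∈ Set.Icc (0 : ℝ) 1 := by
    have hδt := mul_nonneg hδ.le t.2.1
    refine ⟨div_nonneg (add_nonneg (hV_nonneg t) hδt) hm.le, (div_le_one hm).2 ?_⟩
    linarith [hV_mono (unitInterval.le_one' (t := t)), mul_le_of_le_one_right hδ.le t.2.2]
  have hle (s t : I) (hst : s ≤ t) :
      dist (β s) (β t) ≤ m * dist ((V s + δ * s) / m) ((V t + δ * t) / m) := by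
    have hδst : δ * (s : ℝ) ≤ δ * t := mul_le_mul_of_nonneg_left hst hδ.le
    rw [Real.dist_eq, ← sub_div, abs_div, abs_of_pos hm, mul_div_cancel₀ _ hm.ne', abs_sub_comm]
    exact le_trans (by linarith [hV s t hst]) (le_abs_self _)
  refine ⟨⟨m, hm.le⟩, hml, exists_lipschitzWith_of_dist_le
    (φ := fun t => ⟨(V t + δ * t) / m, hbound t⟩) ((by fun_prop : Continuous _).subtype_mk _)
    (Subtype.ext (by simp [hV_zero])) (Subtype.ext (by simp [δ, hm.ne'])) fun s t => ?_⟩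
  rcases le_total s t with hst | hst
  · exact hle s t hst
  · rw [dist_comm, dist_comm (Subtype.mk _ _)]
    exact hle t s hst

end Length

section Lasso

variable {X : Type*} [MetricSpace X] {x₀ : X} {Q : Type*} [Group Q]

theorem IsGeodesicSpace.pathConnectedSpace (hX : IsGeodesicSpace X) (x₀ : X) :
    PathConnectedSpace X :=
  ⟨⟨x₀⟩, fun x y => ⟨hX.geodesicPath x y⟩⟩

/-- The classes of the lassos `α * β * α⁻` whose loop `β` has the property `C`. -/
def lassoSet (x₀ : X) (C : ∀ {y : X}, Path y y → Prop) : Set (FundamentalGroup X x₀) :=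
  {g | ∃ (y : X) (α : Path x₀ y) (β : Path y y), C β ∧ g = lassoClass α β}

theorem lassoClass_trans {y : X} (γ : Path x₀ x₀) (α : Path x₀ y) (β : Path y y) :
    lassoClass (γ.trans α) β = (FundamentalGroup.fromPath ⟪γ⟫)⁻¹ * lassoClass α β *
      FundamentalGroup.fromPath ⟪γ⟫ := by
  rw [FundamentalGroup.mul_def, FundamentalGroup.mul_def, FundamentalGroup.inv_def]
  simp only [lassoClass, FundamentalGroup.fromPath, Path.trans_symm,
    Path.Homotopic.Quotient.mk_trans, Path.Homotopic.Quotient.mk_symm,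
    Path.Homotopic.Quotient.trans_assoc]

theorem normal_closure_lassoSet (x₀ : X) (C : ∀ {y : X}, Path y y → Prop) :
    (Subgroup.closure (lassoSet x₀ C)).Normal := by
  suffices hconj : Group.conjugatesOfSet (lassoSet x₀ C) = lassoSet x₀ C by
    rw [← hconj]
    exact Subgroup.normalClosure_normal
  refine Set.Subset.antisymm (fun g hg => ?_) Group.subset_conjugatesOfSet
  obtain ⟨_, ⟨y, α, β, hβ, rfl⟩, hconj⟩ := Group.mem_conjugatesOfSet_iff.1 hg
  obtain ⟨c, rfl⟩ := isConj_iff.1 hconj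
  obtain ⟨γ, hγ⟩ := Path.Homotopic.Quotient.mk_surjective (FundamentalGroup.toPath c⁻¹)
  refine ⟨y, γ.trans α, β, hβ, ?_⟩
  rw [lassoClass_trans, hγ]
  exact congrArg (· * lassoClass α β * c⁻¹) (inv_inv c).symm

theorem spanierSubgroup_eq_closure_lassoSet (x₀ : X) (r : ℝ) : spanierSubgroup x₀ r =
    Subgroup.closure (lassoSet x₀ fun β => ∃ (w : X) (d : ℝ), d < r ∧
      Set.range β ⊆ Metric.closedBall w d) := by
  simp only [spanierSubgroup, lassoSet, ← exists_and_right, and_assoc]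

instance (x₀ : X) (l : ℝ) : (lengthSubgroup x₀ l).Normal :=
  normal_closure_lassoSet x₀ _

instance (x₀ : X) (r : ℝ) : (spanierSubgroup x₀ r).Normal := by
  rw [spanierSubgroup_eq_closure_lassoSet]
  exact normal_closure_lassoSet x₀ _

instance (x₀ : X) (l : ℝ) : (Subgroup.closure (geodesicLassoClasses x₀ l)).Normal :=
  normal_closure_lassoSet x₀ _

theorem lengthSubgroup_mono (x₀ : X) : Monotone (lengthSubgroup x₀) := by
  refine fun r s h => Subgroup.closure_mono ?_
  rintro _ ⟨y, α, β, hβ, rfl⟩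
  exact ⟨y, α, β, hβ.trans_le (ENNReal.ofReal_le_ofReal h), rfl⟩

theorem spanierSubgroup_mono (x₀ : X) : Monotone (spanierSubgroup x₀) := by
  refine fun r s h => Subgroup.closure_mono ?_
  rintro _ ⟨y, α, β, w, d, hd, hβ, rfl⟩
  exact ⟨y, α, β, w, d, hd.trans_le h, hβ, rfl⟩

theorem range_subset_closedBall_half_pathLength {y : X} {β : Path y y} (hβ : pathLength β ≠ ⊤) :
    Set.range β ⊆ Metric.closedBall y ((pathLength β).toReal / 2) := by
  rintro _ ⟨t, rfl⟩
  obtain ⟨V, -, hV_zero, hV_one, hV⟩ := exists_continuous_arcLength hβ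
  have hto := hV 0 t unitInterval.nonneg'
  have hfrom := hV t 1 unitInterval.le_one'
  rw [β.source, dist_comm] at hto
  rw [β.target] at hfrom
  rw [Metric.mem_closedBall]
  linarith

theorem lengthSubgroup_le_spanierSubgroup (x₀ : X) (l : ℝ) :
    lengthSubgroup x₀ l ≤ spanierSubgroup x₀ (l / 2) := by
  refine Subgroup.closure_mono ?_
  rintro _ ⟨y, α, β, hβ, rfl⟩
  have hfin : pathLength β ≠ ⊤ := ne_top_of_lt hβ
  have hl : (pathLength β).toReal < l := (ENNReal.lt_ofReal_iff_toReal_lt hfin).1 hβ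
  exact ⟨y, α, β, y, _, div_lt_div_of_pos_right hl two_pos,
    range_subset_closedBall_half_pathLength hfin, rfl⟩

theorem exists_lt_mem_spanierSubgroup {r : ℝ} {g : FundamentalGroup X x₀}
    (hg : g ∈ spanierSubgroup x₀ r) : ∃ s < r, g ∈ spanierSubgroup x₀ s := by
  have hmono : Monotone fun s : Set.Iio r => spanierSubgroup x₀ s :=
    fun _ _ h => spanierSubgroup_mono x₀ h
  have hle : spanierSubgroup x₀ r ≤ ⨆ s : Set.Iio r, spanierSubgroup x₀ s := by
    refine (Subgroup.closure_le _).2 ?_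
    rintro _ ⟨y, α, β, w, d, hd, hβ, rfl⟩
    obtain ⟨s, hds, hsr⟩ := exists_between hd
    exact Subgroup.mem_iSup_of_mem (⟨s, hsr⟩ : Set.Iio r)
      (Subgroup.subset_closure ⟨y, α, β, w, d, hds, hβ, rfl⟩)
  obtain ⟨⟨s, hs⟩, hgs⟩ := (Subgroup.mem_iSup_of_directed hmono.directed_le).1 (hle hg)
  exact ⟨s, hs, hgs⟩

namespace PathTransport

theorem map_mk_subpath_zero_one (h : PathTransport X Q) {x y : X} (γ : Path x y) :
    h.map ⟪γ.subpath 0 1⟫ = h.map ⟪γ⟫ := by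
  rw [Path.subpath_zero_one, h.map_mk_cast]

theorem hom_lassoClass_eq_one_iff (h : PathTransport X Q) {y : X} (α : Path x₀ y) (β : Path y y) :
    h.hom x₀ (lassoClass α β) = 1 ↔ h.map ⟪β⟫ = 1 := by
  change h.map ⟪(α.trans β).trans α.symm⟫ = 1 ↔ _
  rw [h.map_mk_trans, h.map_mk_symm, h.map_mk_trans, inv_mul_eq_one, eq_comm, mul_eq_right]

theorem closure_lassoSet_le_ker_iff [PathConnectedSpace X] (h : PathTransport X Q)
    {C : ∀ {y : X}, Path y y → Prop} : Subgroup.closure (lassoSet x₀ C) ≤ (h.hom x₀).ker ↔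
      ∀ ⦃y : X⦄ (β : Path y y), C β → h.map ⟪β⟫ = 1 := by
  rw [Subgroup.closure_le]
  constructor
  · intro hker y β hβ
    exact (h.hom_lassoClass_eq_one_iff (PathConnectedSpace.somePath x₀ y) β).1
      (hker ⟨y, _, β, hβ, rfl⟩)
  · rintro hone _ ⟨y, α, β, hβ, rfl⟩
    exact (h.hom_lassoClass_eq_one_iff α β).2 (hone β hβ)

theorem exists_ker_hom_eq [PathConnectedSpace X] (N : Subgroup (FundamentalGroup X x₀))
    [N.Normal] : ∃ h : PathTransport X (FundamentalGroup X x₀ ⧸ N), (h.hom x₀).ker = N := by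
  let p (y : X) : Path.Homotopic.Quotient x₀ y := ⟪PathConnectedSpace.somePath x₀ y⟫
  let h : PathTransport X (FundamentalGroup X x₀ ⧸ N) :=
    { map := fun {y z} q => QuotientGroup.mk (FundamentalGroup.fromPath
        ((p y).trans (q.trans (p z).symm)))
      map_trans := fun q q' => by
        rw [← QuotientGroup.mk_mul, FundamentalGroup.mul_def]
        congr 1
        simp only [FundamentalGroup.fromPath, Path.Homotopic.Quotient.trans_assoc,
          pathClass_symm_trans_cancel] }
  refine ⟨h, Subgroup.ext fun g => ?_⟩
  let c : FundamentalGroup X x₀ := FundamentalGroup.fromPath (p x₀)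
  have hconj : h.hom x₀ g = QuotientGroup.mk (c⁻¹ * g * c) := by
    rw [FundamentalGroup.mul_def, FundamentalGroup.mul_def, FundamentalGroup.inv_def]
    rfl
  rw [MonoidHom.mem_ker, hconj, QuotientGroup.eq_one_iff]
  exact (Subgroup.Normal.mem_comm_iff ‹_›).trans (by rw [mul_inv_cancel_left])

variable (h : PathTransport X Q)

/-- The transport along each loop of length less than `l` is trivial. -/
def TrivialOnShort (l : ℝ) : Prop :=
  ∀ ⦃y : X⦄ (β : Path y y), pathLength β < ENNReal.ofReal l → h.map ⟪β⟫ = 1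

/-- The transport along each loop in a closed ball of radius less than `r` is trivial. -/
def TrivialOnSmall (r : ℝ) : Prop :=
  ∀ ⦃y : X⦄ (β : Path y y), (∃ (w : X) (d : ℝ), d < r ∧ Set.range β ⊆ Metric.closedBall w d) →
    h.map ⟪β⟫ = 1

variable {h}

theorem lengthSubgroup_le_ker_iff [PathConnectedSpace X] {l : ℝ} :
    lengthSubgroup x₀ l ≤ (h.hom x₀).ker ↔ h.TrivialOnShort l :=
  h.closure_lassoSet_le_ker_iff

theorem spanierSubgroup_le_ker_iff [PathConnectedSpace X] {r : ℝ} :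
    spanierSubgroup x₀ r ≤ (h.hom x₀).ker ↔ h.TrivialOnSmall r := by
  rw [spanierSubgroup_eq_closure_lassoSet]
  exact h.closure_lassoSet_le_ker_iff

end PathTransport

end Lasso

section Decomposition

variable {X : Type*} [MetricSpace X] {Q : Type*} [Group Q] {h : PathTransport X Q}

namespace PathTransport

theorem map_mk_eq_of_trans_symm {y z : X} {γ δ : Path y z} (hγδ : h.map ⟪γ.trans δ.symm⟫ = 1) :
    h.map ⟪γ⟫ = h.map ⟪δ⟫ := by
  rw [h.map_mk_trans, h.map_mk_symm, inv_mul_eq_one] at hγδ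
  exact hγδ.symm

namespace TrivialOnShort

variable {l : ℝ} (hl : h.TrivialOnShort l)

include hl

theorem map_mk_eq {y z : X} {γ δ : Path y z}
    (hlen : pathLength γ + pathLength δ < ENNReal.ofReal l) : h.map ⟪γ⟫ = h.map ⟪δ⟫ :=
  map_mk_eq_of_trans_symm <| hl _ <| (pathLength_trans_le γ δ.symm).trans_lt <| by
    rwa [pathLength_symm]

theorem map_mk_eq_of_lipschitzWith {y z : X} {γ δ : Path y z} {K L : ℝ≥0}
    (hγ : LipschitzWith K γ) (hδ : LipschitzWith L δ) (hKL : (K + L : ℝ) < l) :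
    h.map ⟪γ⟫ = h.map ⟪δ⟫ := by
  refine hl.map_mk_eq ((add_le_add (pathLength_le_of_lipschitzWith hγ)
    (pathLength_le_of_lipschitzWith hδ)).trans_lt ?_)
  rwa [← ENNReal.coe_add, ENNReal.coe_lt_ofReal, NNReal.coe_add]

theorem map_geodesicPath_mul (hX : IsGeodesicSpace X) {x y z : X}
    (hxyz : dist x y + dist y z + dist x z < l) :
    h.map ⟪hX.geodesicPath y z⟫ * h.map ⟪hX.geodesicPath x y⟫ = h.map ⟪hX.geodesicPath x z⟫ := by
  rw [← h.map_mk_trans]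
  have hlen (a b : X) := pathLength_le_of_lipschitzWith (hX.lipschitzWith_geodesicPath a b)
  refine hl.map_mk_eq ((add_le_add ((pathLength_trans_le _ _).trans
    (add_le_add (hlen x y) (hlen y z))) (hlen x z)).trans_lt ?_)
  rwa [← ENNReal.coe_add, ← ENNReal.coe_add, ENNReal.coe_lt_ofReal]

end TrivialOnShort

namespace TrivialOnSmall

variable {r : ℝ} (hr : h.TrivialOnSmall r)

include hr

theorem map_mk_eq {y z w : X} {γ δ : Path y z} {d : ℝ} (hd : d < r)
    (hγ : Set.range γ ⊆ Metric.closedBall w d) (hδ : Set.range δ ⊆ Metric.closedBall w d) :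
    h.map ⟪γ⟫ = h.map ⟪δ⟫ := by
  refine map_mk_eq_of_trans_symm (hr _ ⟨w, d, hd, ?_⟩)
  rw [Path.trans_range, Path.symm_range]
  exact Set.union_subset hγ hδ

theorem map_mk_eq_geodesicPath (hX : IsGeodesicSpace X) {y z : X} {γ : Path y z}
    (hγ : ∀ t, dist (γ t) y < r / 2) : h.map ⟪γ⟫ = h.map ⟪hX.geodesicPath y z⟫ := by
  have hyz : dist y z < r / 2 := by simpa only [γ.target, dist_comm] using hγ 1
  refine hr.map_mk_eq (w := y) (half_lt_self (by linarith [dist_nonneg.trans_lt hyz]))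
    (Set.range_subset_iff.2 fun t => (hγ t).le) (Set.range_subset_iff.2 fun t => ?_)
  rw [Metric.mem_closedBall, dist_comm]
  exact (hX.dist_left_geodesicPath_le y z t).trans hyz.le

end TrivialOnSmall

/-- Coning a loop in a small ball off at the centre cuts it into thin geodesic triangles. -/
theorem TrivialOnShort.trivialOnSmall_half (hX : IsGeodesicSpace X) {l ε : ℝ} (hε : 0 < ε)
    (hl : h.TrivialOnShort l) (hsmall : h.TrivialOnSmall ε) : h.TrivialOnSmall (l / 2) := by
  rintro y β ⟨w, d, hd, hβ⟩
  have hβ_mem (t : I) : dist w (β t) ≤ d := dist_comm w (β t) ▸ hβ ⟨t, rfl⟩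
  have hcone : h.map ⟪β.subpath 0 1⟫ * h.map ⟪hX.geodesicPath w (β 0)⟫ =
      h.map ⟪hX.geodesicPath w (β 1)⟫ := by
    refine unitInterval_rel_zero_one (P := fun a b => h.map ⟪β.subpath a b⟫ *
      h.map ⟪hX.geodesicPath w (β a)⟫ = h.map ⟪hX.geodesicPath w (β b)⟫)
      (fun a b c hab hbc => ?_) fun t => ?_
    · rw [← hbc, ← hab, ← mk_subpath_trans β a b c, h.map_trans, mul_assoc]
    · filter_upwards [eventually_dist_subpath_lt β t (half_pos hε),
        eventually_dist_subpath_lt β t (by linarith : 0 < l - 2 * d)] with ab hab_small hab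
      have hdist := hab 1
      rw [Path.target, dist_comm] at hdist
      rw [hsmall.map_mk_eq_geodesicPath hX hab_small, hl.map_geodesicPath_mul hX]
      linarith [hβ_mem ab.1, hβ_mem ab.2]
  rw [h.map_mk_subpath_zero_one, β.source, β.target] at hcone
  exact mul_eq_right.1 hcone

theorem TrivialOnSmall.map_mk_eq_one_of_dist_lt (hX : IsGeodesicSpace X) {ε : ℝ}
    (hε : h.TrivialOnSmall ε) {y y' : X} {β : Path y y} {β' : Path y' y'}
    (hdist : ∀ t, dist (β t) (β' t) < ε / 4) (hβ : h.map ⟪β⟫ = 1) : h.map ⟪β'⟫ = 1 := by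
  have hpos : 0 < ε / 4 := dist_nonneg.trans_lt (hdist 0)
  have hsquare : h.map ⟪β'.subpath 0 1⟫ * h.map ⟪hX.geodesicPath (β 0) (β' 0)⟫ =
      h.map ⟪hX.geodesicPath (β 1) (β' 1)⟫ * h.map ⟪β.subpath 0 1⟫ := by
    refine unitInterval_rel_zero_one (P := fun a b =>
      h.map ⟪β'.subpath a b⟫ * h.map ⟪hX.geodesicPath (β a) (β' a)⟫ =
      h.map ⟪hX.geodesicPath (β b) (β' b)⟫ * h.map ⟪β.subpath a b⟫)
      (fun a b c hab hbc => ?_) fun t => ?_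
    · rw [← mk_subpath_trans β a b c, ← mk_subpath_trans β' a b c, h.map_trans, h.map_trans,
        mul_assoc, hab, ← mul_assoc, hbc, mul_assoc]
    · filter_upwards [eventually_dist_subpath_lt β t hpos,
        eventually_dist_subpath_lt β' t hpos] with ab hab hab'
      have hgeo (a s : I) : dist (hX.geodesicPath (β a) (β' a) s) (β a) ≤ ε / 4 := by
        rw [dist_comm]
        exact (hX.dist_left_geodesicPath_le _ _ s).trans (hdist a).le
      have hb := hab 1
      rw [Path.target] at hb
      rw [← h.map_mk_trans, ← h.map_mk_trans]
      refine hε.map_mk_eq (w := β ab.1) (d := ε / 2) (by linarith) ?_ ?_ <;>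
        rw [Path.trans_range] <;>
        refine Set.union_subset (Set.range_subset_iff.2 fun s => Metric.mem_closedBall.2 ?_)
          (Set.range_subset_iff.2 fun s => Metric.mem_closedBall.2 ?_)
      · linarith [hgeo ab.1 s]
      · linarith [dist_triangle (β'.subpath ab.1 ab.2 s) (β' ab.1) (β ab.1), hab' s, hdist ab.1,
          dist_comm (β ab.1) (β' ab.1)]
      · linarith [hab s]
      · linarith [dist_triangle (hX.geodesicPath (β ab.2) (β' ab.2) s) (β ab.2) (β ab.1),
          hgeo ab.2 s]
  rw [h.map_mk_subpath_zero_one, h.map_mk_subpath_zero_one, hβ, mul_one, β.source, β.target,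
    β'.source, β'.target] at hsquare
  exact mul_eq_right.1 hsquare

end PathTransport

end Decomposition

section GeodesicCircle

variable {X : Type*} [MetricSpace X]

theorem norm_coe_addCircle_eq_min {l z : ℝ} (hz : 0 ≤ z) (hzl : z ≤ l) :
    ‖(z : AddCircle l)‖ = min z (l - z) := by
  rcases (hz.trans hzl).eq_or_lt with rfl | hl
  · simp [le_antisymm hzl hz]
  rcases le_total z (l / 2) with h | h
  · rw [(AddCircle.norm_coe_eq_abs_iff l hl.ne').2, abs_of_nonneg hz, min_eq_left (by linarith)]
    rwa [abs_of_nonneg hz, abs_of_pos hl]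
  · have hcoe : (z : AddCircle l) = ((z - l : ℝ) : AddCircle l) := by
      rw [AddCircle.coe_sub, AddCircle.coe_period, sub_zero]
    rw [hcoe, (AddCircle.norm_coe_eq_abs_iff l hl.ne').2, abs_of_nonpos (by linarith), neg_sub,
      min_eq_right (by linarith)]
    rw [abs_of_nonpos (by linarith), abs_of_pos hl]
    linarith

theorem dist_coe_addCircle_of_le {l x z : ℝ} (hxz : x ≤ z) (hzl : z - x ≤ l) :
    dist (x : AddCircle l) z = min (z - x) (l - (z - x)) := by
  rw [dist_comm, dist_eq_norm, ← AddCircle.coe_sub,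
    norm_coe_addCircle_eq_min (sub_nonneg.2 hxz) hzl]

theorem isGeodesicCircleLoop_of_dist_eq {l : ℝ} (hl : 0 < l) {y : X} {β : Path y y}
    (h : ∀ s t : I, s ≤ t → dist (β s) (β t) = min (l * (t - s)) (l * (1 - (t - s)))) :
    IsGeodesicCircleLoop l β := by
  have : Fact (0 < l) := ⟨hl⟩
  let f : AddCircle l → X := AddCircle.liftIco l 0 fun x => β.extend (x / l)
  have hf_Ico {x : ℝ} (hx : x ∈ Set.Ico 0 l) : f x = β.extend (x / l) :=
    AddCircle.liftIco_zero_coe_apply hx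
  have hf (t : I) : f ((l * t : ℝ) : AddCircle l) = β t := by
    rcases eq_or_lt_of_le (unitInterval.le_one' (t := t)) with rfl | ht
    · have hcoe : ((l * (1 : I) : ℝ) : AddCircle l) = ((0 : ℝ) : AddCircle l) := by
        simp [AddCircle.coe_period]
      rw [hcoe, hf_Ico ⟨le_rfl, hl⟩, zero_div, β.extend_zero, β.target]
    · rw [hf_Ico ⟨mul_nonneg hl.le t.2.1, mul_lt_of_lt_one_right hl ht⟩,
        mul_div_cancel_left₀ _ hl.ne', β.extend_apply]
  have hsurj (a : AddCircle l) : ∃ t : I, ((l * t : ℝ) : AddCircle l) = a := by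
    have hx : (AddCircle.equivIco l 0 a : ℝ) ∈ Set.Ico 0 l := by
      simpa using (AddCircle.equivIco l 0 a).2
    refine ⟨⟨AddCircle.equivIco l 0 a / l, div_nonneg hx.1 hl.le, (div_le_one hl).2 hx.2.le⟩, ?_⟩
    rw [mul_div_cancel₀ _ hl.ne']
    exact AddCircle.coe_equivIco
  have hdist (s t : I) (hst : s ≤ t) : dist (f ((l * s : ℝ) : AddCircle l))
      (f ((l * t : ℝ) : AddCircle l)) = dist ((l * s : ℝ) : AddCircle l) ((l * t : ℝ) : _) := by
    have hst' : l * (s : ℝ) ≤ l * t := mul_le_mul_of_nonneg_left hst hl.le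
    rw [hf, hf, h s t hst, dist_coe_addCircle_of_le hst' (by nlinarith [s.2.1, t.2.2])]
    ring_nf
  refine ⟨f, ⟨hl, Isometry.of_dist_eq fun a b => ?_⟩, fun t => (hf t).symm⟩
  obtain ⟨s, rfl⟩ := hsurj a
  obtain ⟨t, rfl⟩ := hsurj b
  rcases le_total s t with hst | hst
  · exact hdist s t hst
  · rw [dist_comm, hdist t s hst, dist_comm]

variable {Q : Type*} [Group Q] {h : PathTransport X Q}

theorem unitInterval_dist_of_le {s t : I} (hst : s ≤ t) : dist s t = (t : ℝ) - s := by
  rw [dist_comm, Subtype.dist_eq, Real.dist_eq]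
  exact abs_of_nonneg (sub_nonneg.2 hst)

theorem dist_le_of_lipschitzWith_loop {K : ℝ≥0} {y : X} {β : Path y y} (hβ : LipschitzWith K β)
    {s t : I} (hst : s ≤ t) :
    dist (β s) (β t) ≤ min (K * (t - s) : ℝ) (K * (1 - (t - s))) := by
  have hdist {a b : I} (hab : a ≤ b) : dist (β a) (β b) ≤ K * (b - a) :=
    unitInterval_dist_of_le hab ▸ hβ.dist_le_mul a b
  have hto := hdist (unitInterval.nonneg' (t := s))
  have hfrom := hdist (unitInterval.le_one' (t := t))
  rw [β.source, Set.Icc.coe_zero, sub_zero] at hto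
  rw [β.target, dist_comm, Set.Icc.coe_one] at hfrom
  exact le_min (hdist hst) (by linarith [dist_triangle_left (β s) (β t) y])

namespace PathTransport

/-- The chord between `β s` and `β t` cuts `β` into two loops of length less than `K`. -/
theorem TrivialOnShort.map_mk_eq_one_of_dist_lt (hX : IsGeodesicSpace X) {K : ℝ≥0}
    (hK : h.TrivialOnShort K) {y : X} {β : Path y y} (hβ : LipschitzWith K β) {s t : I}
    (hst : s ≤ t) (harc : dist (β s) (β t) < K * (t - s))
    (hcoarc : dist (β s) (β t) < K * (1 - (t - s))) : h.map ⟪β⟫ = 1 := by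
  have hlip := lipschitzWith_subpath hβ
  have hnndist {a b : I} (hab : a ≤ b) : (nndist a b : ℝ) = b - a := unitInterval_dist_of_le hab
  have hchord : h.map ⟪β.subpath s t⟫ = h.map ⟪hX.geodesicPath (β s) (β t)⟫ := by
    refine hK.map_mk_eq_of_lipschitzWith (hlip s t) (hX.lipschitzWith_geodesicPath _ _) ?_
    rw [NNReal.coe_mul, hnndist hst, coe_nndist]
    linarith
  have hrest : h.map ⟪(β.subpath 0 s).trans (hX.geodesicPath (β s) (β t))⟫ =
      h.map ⟪((β.subpath t 1).cast rfl (β.source.trans β.target.symm)).symm⟫ := by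
    refine hK.map_mk_eq ((add_le_add ((pathLength_trans_le _ _).trans (add_le_add
      (pathLength_le_of_lipschitzWith (hlip 0 s)) (pathLength_le_of_lipschitzWith
      (hX.lipschitzWith_geodesicPath _ _)))) ((pathLength_symm _).trans_le
      (pathLength_le_of_lipschitzWith (hlip t 1)))).trans_lt ?_)
    rw [← ENNReal.coe_add, ← ENNReal.coe_add, ENNReal.coe_lt_ofReal, NNReal.coe_add,
      NNReal.coe_add, NNReal.coe_mul, NNReal.coe_mul, hnndist unitInterval.nonneg',
      hnndist unitInterval.le_one', coe_nndist, Set.Icc.coe_zero, Set.Icc.coe_one]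
    linarith
  rw [h.map_mk_symm, h.map_mk_cast, h.map_mk_trans, ← hchord, ← h.map_trans,
    mk_subpath_trans] at hrest
  rw [h.map_mk_eq_of_subpath β t, hrest, mul_inv_cancel]

theorem TrivialOnShort.map_mk_eq_one_or_isGeodesicCircleLoop (hX : IsGeodesicSpace X) {K : ℝ≥0}
    (hpos : 0 < K) (hK : h.TrivialOnShort K) {y : X} {β : Path y y} (hβ : LipschitzWith K β) :
    h.map ⟪β⟫ = 1 ∨ IsGeodesicCircleLoop K β := by
  by_cases hchord : ∃ s t : I, s ≤ t ∧ dist (β s) (β t) < min (K * (t - s) : ℝ) (K * (1 - (t - s)))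
  · obtain ⟨s, t, hst, hdist⟩ := hchord
    obtain ⟨harc, hcoarc⟩ := lt_min_iff.1 hdist
    exact Or.inl (hK.map_mk_eq_one_of_dist_lt hX hβ hst harc hcoarc)
  · push Not at hchord
    exact Or.inr (isGeodesicCircleLoop_of_dist_eq hpos fun s t hst =>
      (dist_le_of_lipschitzWith_loop hβ hst).antisymm (hchord s t hst))

end PathTransport

end GeodesicCircle

section Kernel

variable {X : Type*} [MetricSpace X] {r : ℝ} {hr : 0 < r}

namespace PathTransport

variable {Q : Type*} [Group Q] {h : PathTransport X Q}

theorem TrivialOnShort.isEdgeCocycle (hX : IsGeodesicSpace X) (hshort : h.TrivialOnShort (3 * r)) :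
    IsEdgeCocycle (rips X r hr) fun x y => h.map ⟪hX.geodesicPath x y⟫ :=
  fun τ hτ u hu v hv w hw => hshort.map_geodesicPath_mul hX <| by
    linarith [dist_lt_of_mem_rips_faces hτ hu hv, dist_lt_of_mem_rips_faces hτ hv hw,
      dist_lt_of_mem_rips_faces hτ hu hw]

/-- The transport on the Rips complex whose value on an edge is that of `h` on a geodesic. -/
def TrivialOnShort.ripsTransport (hX : IsGeodesicSpace X) (hshort : h.TrivialOnShort (3 * r)) :
    PathTransport (Realization (rips X r hr)) Q :=
  cocycleTransport (hshort.isEdgeCocycle hX)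

theorem TrivialOnShort.ripsTransport_edge (hX : IsGeodesicSpace X)
    (hshort : h.TrivialOnShort (3 * r)) {x y : X} (hd : dist x y < r) :
    (hshort.ripsTransport hX).map (edge hr hd) = h.map ⟪hX.geodesicPath x y⟫ := by
  rw [edge, ripsTransport, cocycleTransport_seg, someVertex_vertex, someVertex_vertex]

theorem TrivialOnShort.pullback_ripsTransport_mk (hX : IsGeodesicSpace X)
    (hshort : h.TrivialOnShort (3 * r)) (Φ : FineMap X r hr) {x y : X} (γ : Path x y)
    (hγ : ∀ t, ∀ᶠ ab in 𝓝 (t, t),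
      h.map ⟪γ.subpath ab.1 ab.2⟫ = h.map ⟪hX.geodesicPath (γ ab.1) (γ ab.2)⟫) :
    (Φ.pullback (hshort.ripsTransport hX)).map ⟪γ⟫ = h.map ⟪γ⟫ := by
  refine eq_of_eventually_subpath γ fun t => ?_
  filter_upwards [hγ t, Φ.eventually_mapClass_subpath_eq_edge γ t hr] with ab hgeo ⟨_, hd, hedge⟩
  rw [hgeo, FineMap.pullback_map, hedge, hshort.ripsTransport_edge]

theorem TrivialOnSmall.eventually_map_mk_subpath (hX : IsGeodesicSpace X) {ε : ℝ} (hε : 0 < ε)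
    (hsmall : h.TrivialOnSmall ε) {x y : X} (γ : Path x y) (t : I) : ∀ᶠ ab in 𝓝 (t, t),
      h.map ⟪γ.subpath ab.1 ab.2⟫ = h.map ⟪hX.geodesicPath (γ ab.1) (γ ab.2)⟫ := by
  filter_upwards [eventually_dist_subpath_lt γ t (half_pos hε)] with ab hab
  exact hsmall.map_mk_eq_geodesicPath hX hab

theorem TrivialOnShort.eventually_map_mk_subpath (hX : IsGeodesicSpace X) {l : ℝ} (hl : 0 < l)
    (hshort : h.TrivialOnShort l) {K : ℝ≥0} {x y : X} {γ : Path x y} (hγ : LipschitzWith K γ)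
    (t : I) : ∀ᶠ ab in 𝓝 (t, t),
      h.map ⟪γ.subpath ab.1 ab.2⟫ = h.map ⟪hX.geodesicPath (γ ab.1) (γ ab.2)⟫ := by
  have hcont : Continuous fun ab : I × I => K * dist ab.1 ab.2 + dist (γ ab.1) (γ ab.2) := by
    fun_prop
  filter_upwards [(hcont.tendsto (t, t)).eventually_lt_const (u := l) (by simpa using hl)]
    with ab hab
  exact hshort.map_mk_eq_of_lipschitzWith (lipschitzWith_subpath hγ _ _)
    (hX.lipschitzWith_geodesicPath _ _) hab

/-- Loops in small balls bound discs in the Rips complex at scale `l / 3`, so that they become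
trivial once the transport is factored through that complex. -/
theorem TrivialOnShort.exists_trivialOnSmall (hX : IsGeodesicSpace X) {l : ℝ} (hl : 0 < l)
    (hshort : h.TrivialOnShort l) : ∃ h' : PathTransport X Q, h'.TrivialOnSmall (l / 2) ∧
      ∀ (K : ℝ≥0) (x y : X) (γ : Path x y), LipschitzWith K γ → h'.map ⟪γ⟫ = h.map ⟪γ⟫ := by
  obtain ⟨r, rfl⟩ : ∃ r, 3 * r = l := ⟨l / 3, by ring⟩
  obtain ⟨Φ⟩ := nonempty_fineMap X r (by linarith)
  refine ⟨Φ.pullback (hshort.ripsTransport hX), ?_, fun K x y γ hγ =>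
    hshort.pullback_ripsTransport_mk hX Φ γ (hshort.eventually_map_mk_subpath hX hl hγ)⟩
  rintro y β ⟨w, d, hd, hβ⟩
  rw [FineMap.pullback_map, Φ.mapClass_mk_of_closedBall hX hd β hβ, map_refl]

end PathTransport

namespace FineMap

variable (Φ : FineMap X r hr)

theorem hom_lassoClass_eq_one {x₀ y : X} (α : Path x₀ y) {β : Path y y}
    (hβ : Φ.mapClass ⟪β⟫ = .refl _) : Φ.hom x₀ (lassoClass α β) = 1 := by
  have hclass : Φ.mapClass ⟪(α.trans β).trans α.symm⟫ = .refl _ := by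
    rw [Path.Homotopic.Quotient.mk_trans, Path.Homotopic.Quotient.mk_trans, mapClass_trans,
      mapClass_trans, hβ, Path.Homotopic.Quotient.trans_refl, ← mapClass_trans,
      Path.Homotopic.Quotient.mk_symm, Path.Homotopic.Quotient.trans_symm, mapClass_refl]
  exact hclass

theorem hom_surjective (hX : IsGeodesicSpace X) (x₀ : X) : Function.Surjective (Φ.hom x₀) :=
  Φ.mapClass_surjective hX x₀ x₀

theorem ker_hom (hX : IsGeodesicSpace X) (x₀ : X) :
    (Φ.hom x₀).ker = spanierSubgroup x₀ (3 * r / 2) := by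
  have := hX.pathConnectedSpace x₀
  refine le_antisymm ?_ ((Subgroup.closure_le _).2 ?_)
  · obtain ⟨h, hker⟩ := PathTransport.exists_ker_hom_eq (spanierSubgroup x₀ (3 * r / 2))
    have hsmall := PathTransport.spanierSubgroup_le_ker_iff.1 hker.ge
    have hshort := PathTransport.lengthSubgroup_le_ker_iff.1
      ((lengthSubgroup_le_spanierSubgroup x₀ (3 * r)).trans hker.ge)
    intro g hg
    obtain ⟨γ, rfl⟩ := Path.Homotopic.Quotient.mk_surjective g
    have hΦ : Φ.mapClass ⟪γ⟫ = .refl _ := hg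
    have hfactor := hshort.pullback_ripsTransport_mk hX Φ γ
      (hsmall.eventually_map_mk_subpath hX (by positivity) γ)
    rw [pullback_map, hΦ, PathTransport.map_refl] at hfactor
    exact hker.le hfactor.symm
  · rintro _ ⟨y, α, β, w, d, hd, hβ, rfl⟩
    exact Φ.hom_lassoClass_eq_one α (Φ.mapClass_mk_of_closedBall hX hd β hβ)

end FineMap

theorem bonding_bijective_iff (hX : IsGeodesicSpace X) (x₀ : X) (hr : 0 < r) {s : ℝ} (h : r ≤ s) :
    Function.Bijective (bonding x₀ hr h) ↔
      spanierSubgroup x₀ (3 * r / 2) = spanierSubgroup x₀ (3 * s / 2) := by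
  obtain ⟨Φ⟩ := nonempty_fineMap X r hr
  have hcomp := Φ.hom_inclusion x₀ h
  have hsurj : Function.Surjective (bonding x₀ hr h) := by
    refine Function.Surjective.of_comp (g := Φ.hom x₀) ?_
    rw [← MonoidHom.coe_comp, ← hcomp]
    exact (Φ.inclusion h).hom_surjective hX x₀
  rw [Function.Bijective, and_iff_left hsurj, ← MonoidHom.ker_eq_bot_iff, ← Φ.ker_hom hX x₀,
    ← (Φ.inclusion h).ker_hom hX x₀, hcomp, ← MonoidHom.comap_ker,
    ← MonoidHom.comap_bot (Φ.hom x₀), (Subgroup.comap_injective (Φ.hom_surjective hX x₀)).eq_iff,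
    eq_comm]

end Kernel

section Compactness

variable {X : Type*} [MetricSpace X]

/-- The `K`-Lipschitz loops, as a subset of the space of continuous maps. -/
def lipschitzLoops (X : Type*) [MetricSpace X] (K : ℝ≥0) : Set C(I, X) :=
  {f | f 0 = f 1 ∧ LipschitzWith K f}

theorem toContinuousMap_mem_lipschitzLoops {K : ℝ≥0} {y : X} {β : Path y y}
    (hβ : LipschitzWith K β) : β.toContinuousMap ∈ lipschitzLoops X K :=
  ⟨β.source.trans β.target.symm, hβ⟩

theorem mem_lipschitzLoops_of_forall_gt {K : ℝ≥0} {f : C(I, X)}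
    (h : ∀ L > K, f ∈ lipschitzLoops X L) : f ∈ lipschitzLoops X K := by
  refine ⟨(h (K + 1) (lt_add_one K)).1, LipschitzWith.of_dist_le_mul fun s t => ?_⟩
  have hclosed : IsClosed {L : ℝ≥0 | dist (f s) (f t) ≤ L * dist s t} :=
    isClosed_le continuous_const (by fun_prop)
  have hclosure : closure (Set.Ioi K) ⊆ {L : ℝ≥0 | dist (f s) (f t) ≤ L * dist s t} :=
    closure_minimal (fun L hL => (h L hL).2.dist_le_mul s t) hclosed
  rw [closure_Ioi] at hclosure
  exact hclosure Set.self_mem_Ici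

theorem PathTransport.TrivialOnShort.of_exists_dist_lt (hX : IsGeodesicSpace X) {Q Q' : Type*}
    [Group Q] [Group Q'] {h : PathTransport X Q} {h' : PathTransport X Q'} {l ε : ℝ}
    (hsmall : h.TrivialOnSmall ε) (hsmall' : h'.TrivialOnSmall ε) (hshort' : h'.TrivialOnShort l)
    (hclose : ∀ (K : ℝ≥0) (y : X) (β : Path y y), K < l → LipschitzWith K β →
      ∃ (z : X) (δ : Path z z), (h'.map ⟪δ⟫ = 1 → h.map ⟪δ⟫ = 1) ∧
        ∀ t, dist (β t) (δ t) < ε / 4) : h.TrivialOnShort l := by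
  intro y β hβ
  obtain ⟨K, hK, γ, hγ, hγβ⟩ := exists_lipschitzWith_of_pathLength_lt hβ
  obtain ⟨z, δ, hδ, hdist⟩ := hclose K y γ hK hγ
  have hδ' : h'.map ⟪δ⟫ = 1 := hsmall'.map_mk_eq_one_of_dist_lt hX hdist (hγβ ▸ hshort' β hβ)
  rw [← hγβ]
  refine hsmall.map_mk_eq_one_of_dist_lt hX (fun t => ?_) (hδ hδ')
  rw [dist_comm]
  exact hdist t

variable [CompactSpace X]

theorem isCompact_lipschitzLoops (K : ℝ≥0) : IsCompact (lipschitzLoops X K) := by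
  refine ArzelaAscoli.isCompact_of_equicontinuous _ ?_ ?_
  · have himage : ContinuousMap.toFun '' lipschitzLoops X K =
        {f | f 0 = f 1 ∧ LipschitzWith K f} := by
      refine Set.Subset.antisymm ?_ fun f hf => ⟨⟨f, hf.2.continuous⟩, hf, rfl⟩
      rintro _ ⟨f, hf, rfl⟩
      exact hf
    rw [himage]
    exact ((isClosed_eq (continuous_apply 0) (continuous_apply 1)).and
      (isClosed_setOfPred_lipschitzWith K)).isCompact
  · exact (LipschitzWith.uniformEquicontinuous _ K
      fun f : lipschitzLoops X K => f.2.2).equicontinuous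

theorem exists_finite_loops_dist_lt (K : ℝ≥0) {ε : ℝ} (hε : 0 < ε) :
    ∃ L : Set (Σ y : X, Path y y), L.Finite ∧ ∀ (y : X) (β : Path y y), LipschitzWith K β →
      ∃ β' ∈ L, ∀ t, dist (β t) (β'.2 t) < ε := by
  obtain ⟨C, hC, hfin, hcover⟩ := (isCompact_lipschitzLoops (X := X) K).finite_cover_balls hε
  have := hfin.to_subtype
  refine ⟨Set.range fun f : C => ⟨f.1 0, f.1, rfl, (hC f.2).1.symm⟩, Set.finite_range _,
    fun y β hβ => ?_⟩
  obtain ⟨f, hf, hdist⟩ := Set.mem_iUnion₂.1 (hcover (toContinuousMap_mem_lipschitzLoops hβ))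
  exact ⟨_, ⟨⟨f, hf⟩, rfl⟩, fun t => (ContinuousMap.dist_apply_le_dist t).trans_lt hdist⟩

theorem exists_finite_separating_spanierSubgroup (hX : IsGeodesicSpace X) (x₀ : X) {ε : ℝ}
    (hε : 0 < ε) (b : ℝ) : ∃ F : Set (FundamentalGroup X x₀), F.Finite ∧
      ∀ s s' : ℝ, ε ≤ s → s ≤ s' → s' ≤ b →
        (∀ g ∈ F, g ∈ spanierSubgroup x₀ s' → g ∈ spanierSubgroup x₀ s) →
        spanierSubgroup x₀ s = spanierSubgroup x₀ s' := by
  have := hX.pathConnectedSpace x₀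
  obtain ⟨L, hL, hclose⟩ := exists_finite_loops_dist_lt (X := X) (2 * b).toNNReal
    (by positivity : 0 < ε / 4)
  let c (β : Σ y : X, Path y y) := lassoClass (PathConnectedSpace.somePath x₀ β.1) β.2
  refine ⟨c '' L, hL.image c, fun s s' hs hss' hs' hF =>
    le_antisymm (spanierSubgroup_mono x₀ hss') ?_⟩
  obtain ⟨h, hker⟩ := PathTransport.exists_ker_hom_eq (spanierSubgroup x₀ s)
  obtain ⟨h', hker'⟩ := PathTransport.exists_ker_hom_eq (spanierSubgroup x₀ s')
  have hsmall : h.TrivialOnSmall s := PathTransport.spanierSubgroup_le_ker_iff.1 hker.ge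
  have hsmall' : h'.TrivialOnSmall s := PathTransport.spanierSubgroup_le_ker_iff.1
    ((spanierSubgroup_mono x₀ hss').trans hker'.ge)
  obtain ⟨l, rfl⟩ : ∃ l, l / 2 = s' := ⟨2 * s', by ring⟩
  have hshort' : h'.TrivialOnShort l := PathTransport.lengthSubgroup_le_ker_iff.1
    ((lengthSubgroup_le_spanierSubgroup x₀ l).trans hker'.ge)
  have hshort : h.TrivialOnShort l := by
    refine .of_exists_dist_lt hX hsmall hsmall' hshort' fun K y β hK hβ => ?_
    obtain ⟨δ, hδ, hdist⟩ := hclose y β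
      (hβ.weaken (NNReal.le_toNNReal_of_coe_le (by linarith)))
    refine ⟨δ.1, δ.2, fun hone => ?_, fun t => (hdist t).trans_le (by linarith)⟩
    exact (h.hom_lassoClass_eq_one_iff _ _).1 <| hker.ge <| hF (c δ) ⟨δ, hδ, rfl⟩ <|
      hker'.le ((h'.hom_lassoClass_eq_one_iff _ _).2 hone)
  exact (PathTransport.spanierSubgroup_le_ker_iff.2
    (hshort.trivialOnSmall_half hX (hε.trans_le hs) hsmall)).trans hker.le

theorem eventually_nhdsLT_spanierSubgroup_eq (hX : IsGeodesicSpace X) (x₀ : X) {r : ℝ}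
    (hr : 0 < r) : ∀ᶠ s in 𝓝[<] r, spanierSubgroup x₀ s = spanierSubgroup x₀ r := by
  obtain ⟨F, hfin, hF⟩ := exists_finite_separating_spanierSubgroup hX x₀ (half_pos hr) r
  have hmem : ∀ᶠ s in 𝓝[<] r, ∀ g ∈ F, g ∈ spanierSubgroup x₀ r → g ∈ spanierSubgroup x₀ s := by
    refine (Filter.eventually_all_finite hfin).2 fun g _ => ?_
    by_cases hg : g ∈ spanierSubgroup x₀ r
    · obtain ⟨s, hs, hgs⟩ := exists_lt_mem_spanierSubgroup hg
      filter_upwards [Ioo_mem_nhdsLT hs] with t ht _ using spanierSubgroup_mono x₀ ht.1.le hgs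
    · exact .of_forall fun _ hgr => absurd hgr hg
  filter_upwards [hmem, Ioo_mem_nhdsLT (half_lt_self hr)] with s hs hsr
  exact hF s r hsr.1.le hsr.2.le le_rfl hs

namespace PathTransport

variable {Q : Type*} [Group Q] {h : PathTransport X Q}

theorem TrivialOnSmall.exists_lipschitzWith_map_mk_ne_one (hX : IsGeodesicSpace X) {ε : ℝ}
    (hε : 0 < ε) (hsmall : h.TrivialOnSmall ε) {K : ℝ≥0}
    (hgt : ∀ L > K, ∃ (y : X) (β : Path y y), LipschitzWith L β ∧ h.map ⟪β⟫ ≠ 1) :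
    ∃ (y : X) (β : Path y y), LipschitzWith K β ∧ h.map ⟪β⟫ ≠ 1 := by
  let nontrivial (L : ℝ≥0) : Set C(I, X) :=
    {f | ∃ (y : X) (β : Path y y), LipschitzWith L β ∧ h.map ⟪β⟫ ≠ 1 ∧ β.toContinuousMap = f}
  have hsub (L : ℝ≥0) : nontrivial L ⊆ lipschitzLoops X L := by
    rintro _ ⟨y, β, hβ, -, rfl⟩
    exact toContinuousMap_mem_lipschitzLoops hβ
  have hmono : Monotone fun L : Set.Ioi K => closure (nontrivial L) := fun L L' hL =>
    closure_mono fun _ ⟨y, β, hβ, hne, hf⟩ => ⟨y, β, hβ.weaken hL, hne, hf⟩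
  obtain ⟨f, hf⟩ := IsCompact.nonempty_iInter_of_directed_nonempty_isCompact_isClosed
    (fun L : Set.Ioi K => closure (nontrivial L)) hmono.directed_ge
    (fun L => by
      obtain ⟨y, β, hβ, hne⟩ := hgt L L.2
      exact Set.Nonempty.closure ⟨_, y, β, hβ, hne, rfl⟩)
    (fun L => (isCompact_lipschitzLoops _).closure_of_subset (hsub L))
    (fun L => isClosed_closure)
  have hf_mem (L : ℝ≥0) (hL : L > K) : f ∈ closure (nontrivial L) := Set.mem_iInter.1 hf ⟨L, hL⟩
  obtain ⟨hclosed, hlip⟩ := mem_lipschitzLoops_of_forall_gt fun L hL =>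
    closure_minimal (hsub L) (isCompact_lipschitzLoops L).isClosed (hf_mem L hL)
  refine ⟨f 0, ⟨f, rfl, hclosed.symm⟩, hlip, fun hone => ?_⟩
  obtain ⟨_, ⟨y, β, -, hne, rfl⟩, hdist⟩ :=
    Metric.mem_closure_iff.1 (hf_mem (K + 1) (lt_add_one K)) (ε / 4) (by positivity)
  exact hne (hsmall.map_mk_eq_one_of_dist_lt hX
    (fun t => (ContinuousMap.dist_apply_le_dist t).trans_lt hdist) hone)

theorem TrivialOnShort.exists_isGeodesicCircleLoop (hX : IsGeodesicSpace X) {l ε : ℝ} (hl : 0 < l)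
    (hshort : h.TrivialOnShort l) (hε : 0 < ε) (hsmall : h.TrivialOnSmall ε)
    (hgt : ∀ l' > l, ¬ h.TrivialOnShort l') :
    ∃ (y : X) (β : Path y y), IsGeodesicCircleLoop l β ∧ h.map ⟪β⟫ ≠ 1 := by
  lift l to ℝ≥0 using hl.le
  obtain ⟨y, β, hβ, hne⟩ := hsmall.exists_lipschitzWith_map_mk_ne_one hX hε (K := l) fun L hL => by
    have hnontrivial := hgt L hL
    simp only [TrivialOnShort] at hnontrivial
    push Not at hnontrivial
    obtain ⟨y, β, hβ, hne⟩ := hnontrivial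
    obtain ⟨K, hK, γ, hγ, hγβ⟩ := exists_lipschitzWith_of_pathLength_lt hβ
    exact ⟨y, γ, hγ.weaken hK.le, hγβ ▸ hne⟩
  exact ⟨y, β, (hshort.map_mk_eq_one_or_isGeodesicCircleLoop hX hl hβ).resolve_left hne, hne⟩

end PathTransport

theorem exists_mem_geodesicLassoClasses_notMem (hX : IsGeodesicSpace X) {x₀ : X}
    {N : Subgroup (FundamentalGroup X x₀)} [N.Normal] {l : ℝ} (hl : 0 < l)
    (hle : spanierSubgroup x₀ (l / 2) ≤ N) (hgt : ∀ l' > l, ¬ spanierSubgroup x₀ (l' / 2) ≤ N) :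
    ∃ g ∈ geodesicLassoClasses x₀ l, g ∉ N := by
  have := hX.pathConnectedSpace x₀
  obtain ⟨h, hker⟩ := PathTransport.exists_ker_hom_eq N
  have hsmall := PathTransport.spanierSubgroup_le_ker_iff.1 (hle.trans hker.ge)
  have hshort := PathTransport.lengthSubgroup_le_ker_iff.1
    ((lengthSubgroup_le_spanierSubgroup x₀ l).trans (hle.trans hker.ge))
  obtain ⟨y, β, hβ, hne⟩ := hshort.exists_isGeodesicCircleLoop hX hl (half_pos hl) hsmall
    fun l' hl' hshort' => hgt l' hl' <| (PathTransport.spanierSubgroup_le_ker_iff.2 <|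
      hshort'.trivialOnSmall_half hX (half_pos hl) hsmall).trans hker.le
  exact ⟨_, ⟨y, PathConnectedSpace.somePath x₀ y, β, hβ, rfl⟩,
    fun hg => hne ((h.hom_lassoClass_eq_one_iff _ _).1 (hker.ge hg))⟩

end Compactness

section Critical

variable {X : Type*} [MetricSpace X] {x₀ : X}

theorem IsGeodesicCircleLoop.lipschitzWith {l : ℝ} {y : X} {β : Path y y}
    (h : IsGeodesicCircleLoop l β) : LipschitzWith l.toNNReal β := by
  obtain ⟨f, ⟨hl, hf⟩, hβ⟩ := h
  refine LipschitzWith.of_dist_le_mul fun s t => ?_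
  rw [hβ, hβ, hf.dist_eq, dist_eq_norm, ← AddCircle.coe_sub, Real.coe_toNNReal l hl.le,
    Subtype.dist_eq, Real.dist_eq, ← abs_of_pos hl, ← abs_mul, abs_of_pos hl, mul_sub]
  exact QuotientAddGroup.norm_mk_le_norm (S := AddSubgroup.zmultiples l)

theorem closure_geodesicLassoClasses_le_lengthSubgroup (x₀ : X) {l l' : ℝ} (h : l < l') :
    Subgroup.closure (geodesicLassoClasses x₀ l) ≤ lengthSubgroup x₀ l' := by
  refine Subgroup.closure_mono ?_
  rintro _ ⟨y, α, β, hβ, rfl⟩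
  obtain ⟨f, ⟨hl, -⟩, -⟩ := id hβ
  exact ⟨y, α, β, (pathLength_le_of_lipschitzWith hβ.lipschitzWith).trans_lt
    ((ENNReal.ofReal_lt_ofReal_iff (hl.trans h)).2 h), rfl⟩

theorem spanierSubgroup_half_eq_sup (hX : IsGeodesicSpace X) (x₀ : X) {l l' : ℝ} (hl : 0 < l)
    (hll' : l ≤ l') :
    spanierSubgroup x₀ (l' / 2) = lengthSubgroup x₀ l' ⊔ spanierSubgroup x₀ (l / 2) := by
  have := hX.pathConnectedSpace x₀
  refine le_antisymm ?_ (sup_le (lengthSubgroup_le_spanierSubgroup x₀ l')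
    (spanierSubgroup_mono x₀ (by linarith)))
  obtain ⟨h, hker⟩ := PathTransport.exists_ker_hom_eq
    (lengthSubgroup x₀ l' ⊔ spanierSubgroup x₀ (l / 2))
  have hshort := PathTransport.lengthSubgroup_le_ker_iff.1 (le_sup_left.trans hker.ge)
  have hsmall := PathTransport.spanierSubgroup_le_ker_iff.1 (le_sup_right.trans hker.ge)
  exact (PathTransport.spanierSubgroup_le_ker_iff.2
    (hshort.trivialOnSmall_half hX (half_pos hl) hsmall)).trans hker.le

theorem lengthSubgroup_le_sup_of_le_spanierSubgroup_sup (hX : IsGeodesicSpace X) {l l' : ℝ}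
    (hl : 0 < l) {C : ∀ {y : X}, Path y y → Prop}
    (hC : ∀ ⦃y : X⦄ (β : Path y y), C β → ∃ K : ℝ≥0, LipschitzWith K β)
    (hle : lengthSubgroup x₀ l' ≤
      spanierSubgroup x₀ (l / 2) ⊔ Subgroup.closure (lassoSet x₀ C)) :
    lengthSubgroup x₀ l' ≤ lengthSubgroup x₀ l ⊔ Subgroup.closure (lassoSet x₀ C) := by
  have := hX.pathConnectedSpace x₀
  have := normal_closure_lassoSet x₀ C
  obtain ⟨h, hker⟩ := PathTransport.exists_ker_hom_eq
    (lengthSubgroup x₀ l ⊔ Subgroup.closure (lassoSet x₀ C))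
  have hshort := PathTransport.lengthSubgroup_le_ker_iff.1 (le_sup_left.trans hker.ge)
  obtain ⟨h', hsmall', hlip⟩ := hshort.exists_trivialOnSmall hX hl
  have hlasso' : Subgroup.closure (lassoSet x₀ C) ≤ (h'.hom x₀).ker := by
    refine h'.closure_lassoSet_le_ker_iff.2 fun y β hβ => ?_
    obtain ⟨K, hK⟩ := hC β hβ
    rw [hlip K y y β hK]
    exact h.closure_lassoSet_le_ker_iff.1 (le_sup_right.trans hker.ge) β hβ
  have hshort' : h'.TrivialOnShort l' := PathTransport.lengthSubgroup_le_ker_iff.1 <|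
    hle.trans (sup_le (PathTransport.spanierSubgroup_le_ker_iff.2 hsmall') hlasso')
  refine (PathTransport.lengthSubgroup_le_ker_iff.2 fun y β hβ => ?_).trans hker.le
  obtain ⟨K, -, γ, hγ, hγβ⟩ := exists_lipschitzWith_of_pathLength_lt hβ
  rw [← hγβ, ← hlip K y y γ hγ, hγβ, hshort' β hβ]

theorem exists_isMax_spanierSubgroup_le {N : Subgroup (FundamentalGroup X x₀)} {r s : ℝ}
    (hr : spanierSubgroup x₀ r ≤ N) (hs : ¬ spanierSubgroup x₀ s ≤ N) :
    ∃ t ∈ Set.Ico r s, spanierSubgroup x₀ t ≤ N ∧ ∀ t' > t, ¬ spanierSubgroup x₀ t' ≤ N := by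
  let P : Set ℝ := {t | spanierSubgroup x₀ t ≤ N}
  have hupper : s ∈ upperBounds P := fun t ht =>
    le_of_not_ge fun hst => hs ((spanierSubgroup_mono x₀ hst).trans ht)
  have hlub : IsLUB P (sSup P) := isLUB_csSup ⟨r, hr⟩ ⟨s, hupper⟩
  have hmem : sSup P ∈ P := fun g hg => by
    obtain ⟨t, ht, hgt⟩ := exists_lt_mem_spanierSubgroup hg
    obtain ⟨t', ht', htt'⟩ := exists_lt_of_lt_csSup ⟨r, hr⟩ ht
    exact ht' (spanierSubgroup_mono x₀ htt'.le hgt)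
  refine ⟨sSup P, ⟨hlub.1 hr, (hlub.2 hupper).lt_of_ne ?_⟩, hmem,
    fun t ht hle => (hlub.1 hle).not_gt ht⟩
  rintro rfl
  exact hs hmem

theorem IsCriticalValue.pos {q : ℝ} (h : IsCriticalValue x₀ q) : 0 < q :=
  h.elim (fun hleft => hleft.1) fun hright => hright.1

theorem AreConsecutiveCritical.spanierSubgroup_eq (hX : IsGeodesicSpace X) {q p : ℝ}
    (h : AreConsecutiveCritical x₀ q p) {A : Set (FundamentalGroup X x₀)}
    (hA : lengthSubgroup x₀ (3 * p) = lengthSubgroup x₀ (3 * q) ⊔ Subgroup.closure A) :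
    spanierSubgroup x₀ (3 * p / 2) = spanierSubgroup x₀ (3 * q / 2) ⊔ Subgroup.closure A := by
  have hq := h.2.1.pos
  rw [spanierSubgroup_half_eq_sup hX x₀ (by positivity : 0 < 3 * q) (by linarith [h.1]), hA,
    sup_right_comm, sup_eq_right.2 (lengthSubgroup_le_spanierSubgroup x₀ (3 * q))]

variable [CompactSpace X]

theorem not_isLeftCritical (hX : IsGeodesicSpace X) (x₀ : X) (q : ℝ) : ¬ IsLeftCritical x₀ q := by
  rintro ⟨hq, δ, hδ, hcrit⟩
  have hlt : max 0 (3 * (q - δ) / 2) < 3 * q / 2 := max_lt (by positivity) (by linarith)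
  obtain ⟨s, hs, hlow, hhigh⟩ := ((eventually_nhdsLT_spanierSubgroup_eq hX x₀
    (by positivity : 0 < 3 * q / 2)).and (Ioo_mem_nhdsLT hlt)).exists
  obtain ⟨hs_pos, hδs⟩ := max_lt_iff.1 hlow
  refine hcrit (q - 2 * s / 3) (by linarith) (by linarith) (by linarith) (by linarith)
    ((bonding_bijective_iff hX x₀ _ _).2 ?_)
  rwa [show 3 * (q - (q - 2 * s / 3)) / 2 = s by ring]

theorem isCriticalValue_iff (hX : IsGeodesicSpace X) (x₀ : X) {q : ℝ} (hq : 0 < q) :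
    IsCriticalValue x₀ q ↔
      ∀ l > 3 * q, ¬ spanierSubgroup x₀ (l / 2) ≤ spanierSubgroup x₀ (3 * q / 2) := by
  rw [IsCriticalValue, or_iff_right (not_isLeftCritical hX x₀ q)]
  constructor
  · rintro ⟨hq, hcrit⟩ l hl hle
    refine hcrit (l / 3 - q) (by linarith) (by linarith) ((bonding_bijective_iff hX x₀ _ _).2 ?_)
    rw [show 3 * (q + (l / 3 - q)) / 2 = l / 2 by ring]
    exact le_antisymm (spanierSubgroup_mono x₀ (by linarith)) hle
  · exact fun h => ⟨hq, fun ε hε hle hbij =>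
      h (3 * (q + ε)) (by linarith) ((bonding_bijective_iff hX x₀ _ _).1 hbij).ge⟩

theorem IsCriticalValue.exists_isGeodesicCircle (hX : IsGeodesicSpace X) {q : ℝ}
    (h : IsCriticalValue x₀ q) : ∃ f : AddCircle (3 * q) → X, IsGeodesicCircle (3 * q) f := by
  have hq := h.pos
  obtain ⟨_, ⟨y, α, β, ⟨f, hf, -⟩, -⟩, -⟩ := exists_mem_geodesicLassoClasses_notMem hX
    (by positivity) le_rfl ((isCriticalValue_iff hX x₀ hq).1 h)
  exact ⟨f, hf⟩

theorem IsCriticalValue.le_diam (hX : IsGeodesicSpace X) {q : ℝ} (h : IsCriticalValue x₀ q) :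
    3 * q / 2 ≤ Metric.diam (Set.univ : Set X) := by
  obtain ⟨f, hl, hf⟩ := h.exists_isGeodesicCircle hX
  have hantipodal : dist (f ((3 * q / 2 : ℝ) : AddCircle (3 * q))) (f 0) = 3 * q / 2 := by
    rw [hf.dist_eq, dist_zero_right, AddCircle.norm_half_period_eq, abs_of_pos hl]
  rw [← hantipodal]
  exact Metric.dist_le_diam_of_mem isCompact_univ.isBounded trivial trivial

theorem finite_isCriticalValue (hX : IsGeodesicSpace X) (x₀ : X) {r : ℝ} (hr : 0 < r) :
    {c : ℝ | r < c ∧ IsCriticalValue x₀ c}.Finite := by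
  obtain ⟨F, hfin, hF⟩ := exists_finite_separating_spanierSubgroup hX x₀
    (by positivity : 0 < 3 * r / 2) (Metric.diam (Set.univ : Set X))
  refine Set.Finite.of_finite_image (f := fun c => F ∩ spanierSubgroup x₀ (3 * c / 2))
    (hfin.finite_subsets.subset ?_) (StrictMonoOn.injOn fun c ⟨hrc, hc⟩ c' ⟨_, hc'⟩ hcc' => ?_)
  · rintro _ ⟨c, -, rfl⟩
    exact Set.inter_subset_left
  · refine lt_of_le_not_ge
      (Set.inter_subset_inter_right F (spanierSubgroup_mono x₀ (by linarith))) fun hle => ?_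
    have heq := hF (3 * c / 2) (3 * c' / 2) (by linarith) (by linarith) (hc'.le_diam hX)
      fun g hg hg' => (hle ⟨hg, hg'⟩).2
    exact (isCriticalValue_iff hX x₀ hc.pos).1 hc (3 * c') (by linarith) heq.ge

namespace AreConsecutiveCritical

variable {q p : ℝ}

theorem spanierSubgroup_le (hX : IsGeodesicSpace X) (h : AreConsecutiveCritical x₀ q p) :
    spanierSubgroup x₀ (3 * p / 2) ≤
      spanierSubgroup x₀ (3 * q / 2) ⊔ Subgroup.closure (geodesicLassoClasses x₀ (3 * q)) := by
  have hq := h.2.1.pos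
  by_contra hnot
  obtain ⟨t, ⟨hqt, htp⟩, ht, hmax⟩ := exists_isMax_spanierSubgroup_le le_sup_left hnot
  rcases hqt.eq_or_lt with rfl | hqt
  · obtain ⟨g, hg, hgN⟩ := exists_mem_geodesicLassoClasses_notMem hX (by positivity) ht
      fun l hl => hmax (l / 2) (by linarith)
    exact hgN (Subgroup.mem_sup_right (Subgroup.subset_closure hg))
  · refine h.2.2.2 (2 * t / 3) (by linarith) (by linarith)
      ((isCriticalValue_iff hX x₀ (by linarith)).2 fun l hl hle => ?_)
    rw [show 3 * (2 * t / 3) / 2 = t by ring] at hle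
    exact hmax (l / 2) (by linarith) (hle.trans ht)

theorem lengthSubgroup_eq (hX : IsGeodesicSpace X) (h : AreConsecutiveCritical x₀ q p) :
    lengthSubgroup x₀ (3 * p) =
      lengthSubgroup x₀ (3 * q) ⊔ Subgroup.closure (geodesicLassoClasses x₀ (3 * q)) := by
  have hq := h.2.1.pos
  refine le_antisymm ?_ (sup_le (lengthSubgroup_mono x₀ (by linarith [h.1]))
    (closure_geodesicLassoClasses_le_lengthSubgroup x₀ (by linarith [h.1])))
  exact lengthSubgroup_le_sup_of_le_spanierSubgroup_sup hX (by positivity)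
    (fun y β hβ => ⟨_, IsGeodesicCircleLoop.lipschitzWith hβ⟩)
    ((lengthSubgroup_le_spanierSubgroup x₀ (3 * p)).trans (h.spanierSubgroup_le hX))

end AreConsecutiveCritical

end Critical

end RipsPersistence

end

theorem mainTheorem3 {X : Type*} [MetricSpace X] [CompactSpace X]
    (hX : RipsPersistence.IsGeodesicSpace X) (x₀ : X) :
    -- finitely many critical values above each positive threshold
    (∀ r : ℝ, 0 < r → {c : ℝ | r < c ∧ RipsPersistence.IsCriticalValue x₀ c}.Finite) ∧
    -- generation of the length subgroups between consecutive critical values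
    (∀ q p : ℝ, RipsPersistence.AreConsecutiveCritical x₀ q p →
      ∃ A : Set (FundamentalGroup X x₀), A ⊆ RipsPersistence.geodesicLassoClasses x₀ (3 * q) ∧
        RipsPersistence.lengthSubgroup x₀ (3 * p) =
          RipsPersistence.lengthSubgroup x₀ (3 * q) ⊔ Subgroup.closure A) ∧
    -- every critical value comes from a geodesic circle
    (∀ q : ℝ, RipsPersistence.IsCriticalValue x₀ q →
      ∃ f : AddCircle (3 * q) → X, RipsPersistence.IsGeodesicCircle (3 * q) f) ∧
    -- the same (that is, any such) collection of lassos generates the Spanier-type subgroups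
    (∀ q p : ℝ, RipsPersistence.AreConsecutiveCritical x₀ q p →
      ∀ A : Set (FundamentalGroup X x₀), A ⊆ RipsPersistence.geodesicLassoClasses x₀ (3 * q) →
        RipsPersistence.lengthSubgroup x₀ (3 * p) =
          RipsPersistence.lengthSubgroup x₀ (3 * q) ⊔ Subgroup.closure A →
        RipsPersistence.spanierSubgroup x₀ (3 * p / 2) =
          RipsPersistence.spanierSubgroup x₀ (3 * q / 2) ⊔ Subgroup.closure A) := by
  exact ⟨fun r hr => RipsPersistence.finite_isCriticalValue hX x₀ hr,
    fun q p h => ⟨_, subset_rfl, h.lengthSubgroup_eq hX⟩,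
    fun q h => h.exists_isGeodesicCircle hX,
    fun q p h A _ hA => h.spanierSubgroup_eq hX hA⟩
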